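/- Let $K$ be a field, $B$ an associative unital $K$-algebra, and $A\subseteq B$ a $K$-subalgebra. Suppose that $B$ is a \emph{double extension} $A_P[y_1,y_2;\sigma,\delta,\tau]$ of $A$, where $P=\{p_{12},p_{11}\}\subseteq K$, $\tau=\{\tau_0,\tau_1,\tau_2\}\subseteq A$ and $y_1,y_2\in B$; that is: (i) $B$ is generated as a $K$-algebra by $A$, $y_1$ and $y_2$; (ii) $y_2y_1=p_{12}y_1y_2+p_{11}y_1^2+\tau_1y_1+\tau_2y_2+\tau_0$, and $p_{12}\neq 0$; (iii) $B$ is a free left $A$-module with basis $\{y_1^iy_2^j : i,j\ge 0\}$ and a free right $A$-module with basis $\{y_2^iy_1^j : i,j\ge 0\}$; (iv) $y_1A+y_2A+A=Ay_1+Ay_2+A$; and $\sigma=\begin{bmatrix}\sigma_{11}&\sigma_{12}\\ \sigma_{21}&\sigma_{22}\end{bmatrix}\colon A\to M_{2\times 2}(A)$, $\delta=\begin{bmatrix}\delta_1\\ \delta_2\end{bmatrix}\colon A\to M_{2\times 1}(A)$ are the maps determined by $$\begin{bmatrix}y_1\\ y_2\end{bmatrix}a=\sigma(a)\begin{bmatrix}y_1\\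 y_2\end{bmatrix}+\delta(a)\qquad\text{for all } a\in A.$$ Assume that either $\sigma_{12}=0$, or both $\sigma_{21}=0$ and $p_{11}=0$. Let $\mathcal P$ be any one of the following properties of a ring: left noetherian; right noetherian; domain; prime; semiprime and left noetherian; semiprime and right noetherian; semiprime and left Goldie; semiprime and right Goldie. (A ring is left Goldie if it satisfies the ascending chain condition on left annihilators of subsets and contains no infinite direct sum of nonzero left ideals; right Goldie is defined symmetrically.) If $A$ has the property $\mathcal P$, then $B$ has the property $\mathcal P$. -/

import Mathlib

namespace DoubleOre

section RingProperties

variable (R : Type*) [Ring R]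

/-- Left noetherian: `R` is a noetherian left module over itself. -/
def IsLeftNoetherian : Prop := IsNoetherianRing R

/-- Right noetherian: the opposite ring is left noetherian. -/
def IsRightNoetherian : Prop := IsNoetherianRing Rᵐᵒᵖ

/-- A prime ring: `R ≠ 0`, and `a R b = 0` forces `a = 0` or `b = 0`. -/
def IsPrimeRing : Prop :=
  Nontrivial R ∧ ∀ a b : R, (∀ r : R, a * r * b = 0) → a = 0 ∨ b = 0

/-- A semiprime ring: `a R a = 0` forces `a = 0`. -/
def IsSemiprimeRing : Prop :=
  ∀ a : R, (∀ r : R, a * r * a = 0) → a = 0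

variable {R} in
/-- The left annihilator `{r | r S = 0}` of a subset `S`, as a left ideal. -/
def leftAnnihilator (S : Set R) : Ideal R where
  carrier := {r | ∀ s ∈ S, r * s = 0}
  add_mem' := by
    intro a b ha hb s hs
    rw [add_mul, ha s hs, hb s hs, add_zero]
  zero_mem' := fun s _ => zero_mul s
  smul_mem' := by
    intro c a ha s hs
    rw [smul_eq_mul, mul_assoc, ha s hs, mul_zero]

/-- A left Goldie ring: the ascending chain condition holds for left annihilators, and there is no
infinite direct sum of nonzero left ideals. -/
structure IsLeftGoldie : Prop where
  acc_annihilators : WellFoundedGT (Set.range (leftAnnihilator : Set R → Ideal R))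
  no_infinite_direct_sum : ∀ I : ℕ → Ideal R, iSupIndep I → ∃ n, I n = ⊥

/-- Right Goldie: the opposite ring is left Goldie. -/
def IsRightGoldie : Prop := IsLeftGoldie Rᵐᵒᵖ

end RingProperties

/-- The family `v` is a basis of the left `R`-module `M`. -/
def IsFreeBasis (R : Type*) {M ι : Type*} [Ring R] [AddCommGroup M] [Module R M]
    (v : ι → M) : Prop :=
  LinearIndependent R v ∧ Submodule.span R (Set.range v) = ⊤

section DoubleExtension

variable {K B : Type*} [Field K] [Ring B] [Algebra K B]

/-- The subset `A y₁ + A y₂ + A` of `B`. -/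
def leftLinear (A : Subalgebra K B) (y₁ y₂ : B) : Set B :=
  {b | ∃ a₁ a₂ a₀ : A, b = a₁ * y₁ + a₂ * y₂ + a₀}

/-- The subset `y₁ A + y₂ A + A` of `B`. -/
def rightLinear (A : Subalgebra K B) (y₁ y₂ : B) : Set B :=
  {b | ∃ a₁ a₂ a₀ : A, b = y₁ * a₁ + y₂ * a₂ + a₀}

/-- `B` is a right double extension of its subalgebra `A`, with variables `y₁, y₂`, parameter
`{p₁₂, p₁₁}` and tail `{τ₀, τ₁, τ₂}`. -/
structure IsRightDoubleExtension (A : Subalgebra K B) (y₁ y₂ : B) (p₁₂ p₁₁ : K)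
    (τ₀ τ₁ τ₂ : A) : Prop where
  generated : Algebra.adjoin K ((A : Set B) ∪ {y₁, y₂}) = ⊤
  relation : y₂ * y₁ = p₁₂ • (y₁ * y₂) + p₁₁ • y₁ ^ 2 + τ₁ * y₁ + τ₂ * y₂ + τ₀
  left_basis : IsFreeBasis A (fun n : ℕ × ℕ => y₁ ^ n.1 * y₂ ^ n.2)
  right_subset_left : rightLinear A y₁ y₂ ⊆ leftLinear A y₁ y₂

/-- `B` is a double extension of its subalgebra `A`. The right `A`-module `B` is viewed as the left
module `Bᵐᵒᵖ` over the opposite subalgebra `A.op`. -/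
structure IsDoubleExtension (A : Subalgebra K B) (y₁ y₂ : B) (p₁₂ p₁₁ : K)
    (τ₀ τ₁ τ₂ : A) : Prop extends IsRightDoubleExtension A y₁ y₂ p₁₂ p₁₁ τ₀ τ₁ τ₂ where
  p₁₂_ne_zero : p₁₂ ≠ 0
  right_basis : IsFreeBasis A.op (fun n : ℕ × ℕ => MulOpposite.op (y₂ ^ n.1 * y₁ ^ n.2))
  right_eq_left : rightLinear A y₁ y₂ = leftLinear A y₁ y₂

/-- The maps `σ : A → M₂ₓ₂(A)` and `δ : A → M₂ₓ₁(A)` are those of the extension: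
`(y₁, y₂)ᵗ a = σ(a) (y₁, y₂)ᵗ + δ(a)`. The indices `0, 1` stand for `1, 2`. -/
def IsStructureMaps (A : Subalgebra K B) (y₁ y₂ : B)
    (σ : A → Matrix (Fin 2) (Fin 2) A) (δ : A → Fin 2 → A) : Prop :=
  ∀ a : A,
    y₁ * a = σ a 0 0 * y₁ + σ a 0 1 * y₂ + δ a 0 ∧
    y₂ * a = σ a 1 0 * y₁ + σ a 1 1 * y₂ + δ a 1

end DoubleExtension

end DoubleOre

/-! Under either hypothesis `B` is an iterated Ore extension whose two twisting maps are
automorphisms: `A[y₁][y₂]` when σ₁₂ = 0 (`transfersTo_of_lower`), and `A[y₂][y₁]` when σ₂₁ = 0 and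
p₁₁ = 0 (`transfersTo_of_upper`). It then suffices that each property passes from `R` to `R[y; σ,
δ]` with σ an automorphism (`IsOreExtension.transfersTo`).

The delicate point in the decomposition is bijectivity on `A`. Condition (iv) gives a y₁ = y₁b₁ +
y₂b₂ + b₀, and the left basis forces σ₂₂(b₂) = 0 when σ₁₂ = 0. So the y₂-term disappears once σ₂₂ is
injective, which follows by computing y₂y₁b in two ways and using the right basis
(`eq_zero_of_sigma_snd_snd_eq_zero`). In the other case σ₁₁ plays this role
(`eq_zero_of_sigma_fst_fst_eq_zero`).

The transfer rests on leading coefficients written on the right, with the product rule lc(st) =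
σ⁻ⁿ(lc s) lc t for n = deg t, wherever this is nonzero. Domain and prime are immediate, and
noetherian is Hilbert's argument. If f S f = 0, widely spaced σ-translates of lc f generate
independent left ideals of a semiprime `R`, so finiteness forces f = 0. For Goldie, a semiprime left
Goldie ring is left nonsingular; nonsingularity passes to `S`; counting dimensions along the degree
filtration rules out infinite direct sums; and nonsingularity with no infinite sums returns the
chain condition. Right-handed statements come from the opposite ring. -/

namespace DoubleOre

/-! ### Ore extensions: degree filtration and leading coefficients -/

section OreExtension

variable {R S : Type*} [Ring R] [Ring S]

/-- The additive subgroup of the left polynomials `∑ ι(rᵢ) yⁱ` of degree less than `n`. -/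
def degreeLT (ι : R →+* S) (y : S) : ℕ → AddSubgroup S
  | 0 => ⊥
  | n + 1 => degreeLT ι y n ⊔ ((AddMonoidHom.mulRight (y ^ n)).comp ι.toAddMonoidHom).range

variable {ι : R →+* S} {y : S} {σ : R ≃+* R}

theorem mem_degreeLT_zero {s : S} : s ∈ degreeLT ι y 0 ↔ s = 0 := Iff.rfl

theorem mem_degreeLT_succ {n : ℕ} {s : S} :
    s ∈ degreeLT ι y (n + 1) ↔ ∃ r : R, ∃ t ∈ degreeLT ι y n, s = ι r * y ^ n + t := by
  rw [degreeLT, AddSubgroup.mem_sup]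
  constructor
  · rintro ⟨t, ht, _, ⟨r, rfl⟩, rfl⟩
    exact ⟨r, t, ht, add_comm _ _⟩
  · rintro ⟨r, t, ht, rfl⟩
    exact ⟨t, ht, _, ⟨r, rfl⟩, add_comm _ _⟩

theorem degreeLT_mono : Monotone (degreeLT ι y) :=
  monotone_nat_of_le_succ fun _ => le_sup_left

theorem map_mul_pow_mem {n m : ℕ} (h : n < m) (r : R) : ι r * y ^ n ∈ degreeLT ι y m :=
  degreeLT_mono h (mem_degreeLT_succ.2 ⟨r, 0, zero_mem _, (add_zero _).symm⟩)

theorem pow_mem_degreeLT {n m : ℕ} (h : n < m) : y ^ n ∈ degreeLT ι y m := by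
  simpa using map_mul_pow_mem (ι := ι) (y := y) h 1

theorem map_mem_degreeLT_one (r : R) : ι r ∈ degreeLT ι y 1 := by
  simpa using map_mul_pow_mem (ι := ι) (y := y) zero_lt_one r

theorem degreeLT_induction {n : ℕ} {P : S → Prop} (h0 : P 0)
    (hadd : ∀ s t, P s → P t → P (s + t)) (hmon : ∀ i < n, ∀ r, P (ι r * y ^ i)) :
    ∀ s ∈ degreeLT ι y n, P s := by
  induction n with
  | zero => rintro s hs; rw [mem_degreeLT_zero.1 hs]; exact h0
  | succ n ih =>
    intro s hs
    obtain ⟨r, t, ht, rfl⟩ := mem_degreeLT_succ.1 hs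
    exact hadd _ _ (hmon n n.lt_succ_self r) (ih (fun i hi => hmon i (by omega)) t ht)

theorem map_mul_mem {n : ℕ} (r : R) {s : S} (hs : s ∈ degreeLT ι y n) :
    ι r * s ∈ degreeLT ι y n := by
  refine degreeLT_induction (P := fun s => ι r * s ∈ degreeLT ι y n) ?_ ?_ ?_ s hs
  · simp
  · intro s t hs ht; rw [mul_add]; exact add_mem hs ht
  · intro i hi r'
    rw [← mul_assoc, ← map_mul]
    exact map_mul_pow_mem hi _

theorem mul_pow_mem {n : ℕ} (k : ℕ) {s : S} (hs : s ∈ degreeLT ι y n) :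
    s * y ^ k ∈ degreeLT ι y (n + k) := by
  refine degreeLT_induction (P := fun s => s * y ^ k ∈ degreeLT ι y (n + k)) ?_ ?_ ?_ s hs
  · simp
  · intro s t hs ht; rw [add_mul]; exact add_mem hs ht
  · intro i hi r'
    rw [mul_assoc, ← pow_add]
    exact map_mul_pow_mem (by omega) _

theorem exists_left_sum_of_mem_degreeLT {n : ℕ} {s : S} (hs : s ∈ degreeLT ι y n) :
    ∃ f : ℕ → R, s = ∑ i ∈ Finset.range n, ι (f i) * y ^ i := by
  induction n generalizing s with
  | zero => exact ⟨0, by simpa using mem_degreeLT_zero.1 hs⟩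
  | succ n ih =>
    obtain ⟨r, t, ht, rfl⟩ := mem_degreeLT_succ.1 hs
    obtain ⟨f, rfl⟩ := ih ht
    refine ⟨Function.update f n r, ?_⟩
    rw [Finset.sum_range_succ, Function.update_self, add_comm]
    congr 1
    refine Finset.sum_congr rfl fun i hi => ?_
    rw [Function.update_of_ne (Finset.mem_range.1 hi).ne]

theorem map_mem_degreeLT {T : Type*} [Ring T] (φ : S →+* T) {n : ℕ} {s : S}
    (hs : s ∈ degreeLT ι y n) : φ s ∈ degreeLT (φ.comp ι) (φ y) n := by
  obtain ⟨f, rfl⟩ := exists_left_sum_of_mem_degreeLT hs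
  rw [map_sum]
  refine sum_mem fun i hi => ?_
  rw [map_mul, map_pow]
  exact map_mul_pow_mem (ι := φ.comp ι) (Finset.mem_range.1 hi) (f i)

section Comm

variable (hc : ∀ r, ∃ d, y * ι r = ι (σ r) * y + ι d)
include hc

theorem mul_mem_of_comm {n : ℕ} {s : S} (hs : s ∈ degreeLT ι y n) :
    y * s ∈ degreeLT ι y (n + 1) := by
  refine degreeLT_induction (P := fun s => y * s ∈ degreeLT ι y (n + 1)) ?_ ?_ ?_ s hs
  · simp
  · intro s t hs ht; rw [mul_add]; exact add_mem hs ht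
  · intro i hi r
    obtain ⟨d, hd⟩ := hc r
    rw [← mul_assoc, hd, add_mul, mul_assoc, ← pow_succ']
    exact add_mem (map_mul_pow_mem (by omega) _) (map_mul_pow_mem (by omega) _)

theorem pow_mul_mem {n : ℕ} (k : ℕ) {s : S} (hs : s ∈ degreeLT ι y n) :
    y ^ k * s ∈ degreeLT ι y (n + k) := by
  induction k with
  | zero => simpa
  | succ k ih =>
    rw [pow_succ', mul_assoc]
    exact mul_mem_of_comm hc ih

theorem pow_mul_map_sub_mem (n : ℕ) (r : R) :
    y ^ n * ι r - ι ((σ ^ n) r) * y ^ n ∈ degreeLT ι y n := by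
  induction n with
  | zero => simp
  | succ n ih =>
    obtain ⟨d, hd⟩ := hc ((σ ^ n) r)
    have key : y ^ (n + 1) * ι r - ι ((σ ^ (n + 1)) r) * y ^ (n + 1)
        = y * (y ^ n * ι r - ι ((σ ^ n) r) * y ^ n) + ι d * y ^ n := by
      have : (σ ^ (n + 1)) r = σ ((σ ^ n) r) := by rw [pow_succ']; rfl
      rw [this, mul_sub, ← mul_assoc y (ι _), hd, pow_succ']
      noncomm_ring
    rw [key]
    exact add_mem (mul_mem_of_comm hc ih) (map_mul_pow_mem n.lt_succ_self _)

theorem map_mul_pow_sub_mem (n : ℕ) (r : R) :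
    ι r * y ^ n - y ^ n * ι ((σ.symm ^ n) r) ∈ degreeLT ι y n := by
  have h := pow_mul_map_sub_mem hc n ((σ.symm ^ n) r)
  have e : (σ ^ n) ((σ.symm ^ n) r) = r := by
    have : σ.symm = σ⁻¹ := rfl
    rw [this, inv_pow]
    exact (σ ^ n).apply_symm_apply r
  rw [e] at h
  simpa using neg_mem h

theorem pow_mul_map_mem {i n : ℕ} (h : i < n) (r : R) : y ^ i * ι r ∈ degreeLT ι y n := by
  have := add_mem (degreeLT_mono h.le (pow_mul_map_sub_mem hc i r))
    (map_mul_pow_mem (ι := ι) (y := y) h ((σ ^ i) r))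
  simpa using this

/-- Moving the top coefficient across `yⁿ` costs only `σ⁻ⁿ` and terms of lower degree. So the
filtration is the same for left and right coefficients; this uses that σ is bijective. -/
theorem mem_degreeLT_succ_right {n : ℕ} {s : S} :
    s ∈ degreeLT ι y (n + 1) ↔ ∃ r : R, s - y ^ n * ι r ∈ degreeLT ι y n := by
  constructor
  · intro hs
    obtain ⟨r, t, ht, rfl⟩ := mem_degreeLT_succ.1 hs
    refine ⟨(σ.symm ^ n) r, ?_⟩
    rw [add_sub_right_comm]
    exact add_mem (map_mul_pow_sub_mem hc n r) ht
  · rintro ⟨r, hr⟩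
    have := add_mem (degreeLT_mono n.le_succ hr) (pow_mul_map_mem hc n.lt_succ_self r)
    simpa using this

theorem mul_map_mem {n : ℕ} (r : R) {s : S} (hs : s ∈ degreeLT ι y n) :
    s * ι r ∈ degreeLT ι y n := by
  refine degreeLT_induction (P := fun s => s * ι r ∈ degreeLT ι y n) ?_ ?_ ?_ s hs
  · simp
  · intro s t hs ht; rw [add_mul]; exact add_mem hs ht
  · intro i hi r'
    rw [mul_assoc]
    exact map_mul_mem _ (pow_mul_map_mem hc hi r)

theorem mul_mem_degreeLT {m n : ℕ} {s t : S} (hs : s ∈ degreeLT ι y m)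
    (ht : t ∈ degreeLT ι y (n + 1)) : s * t ∈ degreeLT ι y (m + n) := by
  refine degreeLT_induction (P := fun t => s * t ∈ degreeLT ι y (m + n)) ?_ ?_ ?_ t ht
  · simp
  · intro s t hs ht; rw [mul_add]; exact add_mem hs ht
  · intro i hi r
    rw [← mul_assoc]
    exact degreeLT_mono (by omega) (mul_pow_mem i (mul_map_mem hc r hs))

/-- Freeness on the powers of `y` on the right implies freeness on the left. -/
theorem eq_zero_of_map_mul_pow_mem (hu : ∀ n r, y ^ n * ι r ∈ degreeLT ι y n → r = 0)
    (n : ℕ) (r : R) (hr : ι r * y ^ n ∈ degreeLT ι y n) : r = 0 := by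
  have h := sub_mem hr (map_mul_pow_sub_mem hc n r)
  rw [sub_sub_cancel] at h
  exact (map_eq_zero_iff _ (σ.symm ^ n).injective).1 (hu n _ h)

theorem exists_mem_degreeLT_of_adjoin {K : Type*} [CommRing K] [Algebra K S] {X : Set S}
    (hX : Algebra.adjoin K X = ⊤) (hmem : ∀ x ∈ X, x ∈ Set.range ι ∨ x = y)
    (hK : ∀ k : K, algebraMap K S k ∈ Set.range ι) (s : S) : ∃ n, s ∈ degreeLT ι y n := by
  have hs : s ∈ Algebra.adjoin K X := hX ▸ Algebra.mem_top
  induction hs using Algebra.adjoin_induction with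
  | mem x hx =>
    rcases hmem x hx with ⟨r, rfl⟩ | rfl
    · exact ⟨1, map_mem_degreeLT_one r⟩
    · exact ⟨2, by simpa using pow_mem_degreeLT (ι := ι) (y := x) (n := 1) (m := 2) (by omega)⟩
  | algebraMap k =>
    obtain ⟨r, hr⟩ := hK k
    exact ⟨1, hr ▸ map_mem_degreeLT_one r⟩
  | add x z _ _ hx hz =>
    obtain ⟨m, hm⟩ := hx
    obtain ⟨n, hn⟩ := hz
    exact ⟨m + n, add_mem (degreeLT_mono (by omega) hm) (degreeLT_mono (by omega) hn)⟩
  | mul x z _ _ hx hz =>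
    obtain ⟨m, hm⟩ := hx
    obtain ⟨n, hn⟩ := hz
    exact ⟨m + n, mul_mem_degreeLT hc hm (degreeLT_mono n.le_succ hn)⟩

theorem exists_right_sum_of_mem_degreeLT {n : ℕ} {s : S} (hs : s ∈ degreeLT ι y n) :
    ∃ f : ℕ → R, s = ∑ i ∈ Finset.range n, y ^ i * ι (f i) := by
  induction n generalizing s with
  | zero => exact ⟨0, by simpa using mem_degreeLT_zero.1 hs⟩
  | succ n ih =>
    obtain ⟨r, hr⟩ := (mem_degreeLT_succ_right hc).1 hs
    obtain ⟨f, hf⟩ := ih hr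
    refine ⟨Function.update f n r, ?_⟩
    rw [Finset.sum_range_succ, Function.update_self, ← sub_eq_iff_eq_add, hf]
    refine Finset.sum_congr rfl fun i hi => ?_
    rw [Function.update_of_ne (Finset.mem_range.1 hi).ne]

end Comm

/-- `S` is an Ore extension `R[y; σ, δ]` with `σ` an automorphism, where `R` is embedded in `S` by
`ι`. -/
structure IsOreExtension (ι : R →+* S) (σ : R ≃+* R) (y : S) : Prop where
  comm : ∀ r, ∃ d, y * ι r = ι (σ r) * y + ι d
  uniq : ∀ n r, ι r * y ^ n ∈ degreeLT ι y n → r = 0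
  exhaust : ∀ s, ∃ n, s ∈ degreeLT ι y n

/-- The commutation rules determine the automorphism. -/
theorem exists_automorphism
    (hL : ∀ r, ∃ r' d, y * ι r = ι r' * y + ι d)
    (hR : ∀ r, ∃ r' d, ι r * y = y * ι r' + ι d)
    (uL : ∀ r d, ι r * y = ι d → r = 0) (uR : ∀ r d, y * ι r = ι d → r = 0) :
    ∃ σ : R ≃+* R, ∀ r, ∃ d, y * ι r = ι (σ r) * y + ι d := by
  choose f d hf using hL
  -- Uniqueness reduces every homomorphism law, and surjectivity, to exhibiting one expression of
  -- the right shape.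
  have huniq : ∀ r r' e, y * ι r = ι r' * y + ι e → f r = r' := by
    intro r r' e h
    rw [hf r] at h
    rw [← sub_eq_zero]
    apply uL _ (e - d r)
    rw [map_sub, map_sub, sub_mul, sub_eq_sub_iff_add_eq_add, add_comm (ι e)]
    rw [h, add_comm]
  let φ : R →+* R :=
    { toFun := f
      map_one' := huniq 1 1 0 (by simp)
      map_mul' := fun a b => huniq _ _ (f a * d b + d a * b) (by
        rw [map_mul, ← mul_assoc, hf a, add_mul, mul_assoc, hf b]
        simp only [map_mul, map_add, mul_add, mul_assoc, add_assoc])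
      map_zero' := huniq 0 0 0 (by simp)
      map_add' := fun a b => huniq _ _ (d a + d b) (by
        rw [map_add, mul_add, hf a, hf b]
        simp only [map_add, add_mul]
        abel) }
  have hbij : Function.Bijective φ := by
    constructor
    · rw [injective_iff_map_eq_zero]
      intro r hr
      apply uR r (d r)
      rw [hf r, show f r = 0 from hr]
      simp
    · intro r
      obtain ⟨r', e, h⟩ := hR r
      exact ⟨r', huniq r' r (-e) (by rw [h]; simp)⟩
  exact ⟨RingEquiv.ofBijective φ hbij, fun r => ⟨d r, hf r⟩⟩

theorem mem_degreeLT_op (hc : ∀ r, ∃ d, y * ι r = ι (σ r) * y + ι d) {n : ℕ} {s : S} :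
    MulOpposite.op s ∈ degreeLT (RingHom.op ι) (MulOpposite.op y) n ↔ s ∈ degreeLT ι y n := by
  induction n generalizing s with
  | zero => simp [mem_degreeLT_zero]
  | succ n ih =>
    rw [mem_degreeLT_succ_right hc, mem_degreeLT_succ]
    constructor
    · rintro ⟨r, t, ht, h⟩
      refine ⟨r.unop, ?_⟩
      rw [← ih]
      have : MulOpposite.op (s - y ^ n * ι r.unop) = t := by
        rw [MulOpposite.op_sub, h]; simp
      rwa [this]
    · rintro ⟨r, hr⟩
      refine ⟨MulOpposite.op r, _, ih.2 hr, ?_⟩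
      simp

/-- Reading the commutation rule backwards replaces σ by its inverse. This gives every right-handed
transfer from the left-handed one. -/
theorem IsOreExtension.op (h : IsOreExtension ι σ y) :
    IsOreExtension (RingHom.op ι) (RingEquiv.op σ.symm) (MulOpposite.op y) where
  comm r := by
    obtain ⟨d, hd⟩ := h.comm (σ.symm r.unop)
    refine ⟨MulOpposite.op (-d), ?_⟩
    apply MulOpposite.unop_injective
    rw [RingEquiv.apply_symm_apply] at hd
    simp [hd]
  uniq n r hr := by
    have h1 : y ^ n * ι r.unop ∈ degreeLT ι y n := by
      rw [← mem_degreeLT_op h.comm]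
      simpa using hr
    have h2 := sub_mem h1 (pow_mul_map_sub_mem h.comm n r.unop)
    rw [sub_sub_cancel] at h2
    apply MulOpposite.unop_injective
    exact (map_eq_zero_iff _ (σ ^ n).injective).1 (h.uniq n _ h2)
  exhaust s := (h.exhaust s.unop).imp fun _ hn => (mem_degreeLT_op h.comm).2 hn

/-- `s` has degree at most `n`, and `r` is its coefficient at `yⁿ`, written on the right. -/
def HasLead (ι : R →+* S) (y : S) (n : ℕ) (s : S) (r : R) : Prop :=
  s - y ^ n * ι r ∈ degreeLT ι y n

theorem hasLead_map (r : R) : HasLead ι y 0 (ι r) r := by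
  simp [HasLead]

theorem hasLead_pow (n : ℕ) : HasLead ι y n (y ^ n) 1 := by
  simp [HasLead]

theorem HasLead.add {n : ℕ} {s t : S} {a b : R} (hs : HasLead ι y n s a)
    (ht : HasLead ι y n t b) : HasLead ι y n (s + t) (a + b) := by
  have := add_mem hs ht
  rwa [HasLead, map_add, mul_add, add_sub_add_comm]

theorem HasLead.sub {n : ℕ} {s t : S} {a b : R} (hs : HasLead ι y n s a)
    (ht : HasLead ι y n t b) : HasLead ι y n (s - t) (a - b) := by
  have := sub_mem hs ht
  rwa [HasLead, map_sub, mul_sub, sub_sub_sub_comm]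

theorem hasLead_zero_iff {n : ℕ} {s : S} : HasLead ι y n s 0 ↔ s ∈ degreeLT ι y n := by
  simp [HasLead]

theorem HasLead.sum {α : Type*} {n : ℕ} (t : Finset α) {s : α → S} {a : α → R}
    (h : ∀ i ∈ t, HasLead ι y n (s i) (a i)) :
    HasLead ι y n (∑ i ∈ t, s i) (∑ i ∈ t, a i) := by
  have := sum_mem h
  rwa [HasLead, map_sum, Finset.mul_sum, ← Finset.sum_sub_distrib]

namespace IsOreExtension

variable (h : IsOreExtension ι σ y)
include h

theorem injective : Function.Injective ι := by
  rw [injective_iff_map_eq_zero]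
  intro r hr
  exact h.uniq 0 r (by simp [hr])

theorem hasLead_unique {n : ℕ} {s : S} {a b : R} (ha : HasLead ι y n s a)
    (hb : HasLead ι y n s b) : a = b := by
  have h1 := ha.sub hb
  rw [sub_self, HasLead, zero_sub, neg_mem_iff] at h1
  have h2 := sub_mem h1 (pow_mul_map_sub_mem h.comm n (a - b))
  rw [sub_sub_cancel] at h2
  exact sub_eq_zero.1 ((map_eq_zero_iff _ (σ ^ n).injective).1 (h.uniq n _ h2))

theorem exists_hasLead {n : ℕ} {s : S} (hs : s ∈ degreeLT ι y (n + 1)) :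
    ∃ r, HasLead ι y n s r :=
  (mem_degreeLT_succ_right h.comm).1 hs

theorem mem_of_hasLead {n : ℕ} {s : S} {r : R} (hs : HasLead ι y n s r) :
    s ∈ degreeLT ι y (n + 1) :=
  (mem_degreeLT_succ_right h.comm).2 ⟨r, hs⟩

theorem exists_hasLead_ne_zero {s : S} (hs : s ≠ 0) : ∃ n r, r ≠ 0 ∧ HasLead ι y n s r := by
  obtain ⟨n, hn⟩ := h.exhaust s
  induction n with
  | zero => exact absurd hn hs
  | succ n ih =>
    obtain ⟨r, hr⟩ := h.exists_hasLead hn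
    by_cases h0 : r = 0
    · subst h0
      exact ih (hasLead_zero_iff.1 hr)
    · exact ⟨n, r, h0, hr⟩

/-- Only `a` has to cross `yⁿ`; all corrections have degree below `m + n`. -/
theorem hasLead_mul {m n : ℕ} {s t : S} {a b : R} (hs : HasLead ι y m s a)
    (ht : HasLead ι y n t b) : HasLead ι y (m + n) (s * t) ((σ.symm ^ n) a * b) := by
  have key : s * t - y ^ (m + n) * ι ((σ.symm ^ n) a * b)
      = (s - y ^ m * ι a) * t + y ^ m * (ι a * (t - y ^ n * ι b))
        + y ^ m * ((ι a * y ^ n - y ^ n * ι ((σ.symm ^ n) a)) * ι b) := by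
    rw [map_mul, pow_add]
    noncomm_ring
  rw [HasLead, key]
  refine add_mem (add_mem (mul_mem_degreeLT h.comm hs (h.mem_of_hasLead ht)) ?_) ?_
  · rw [add_comm m n]
    exact pow_mul_mem h.comm m (map_mul_mem a ht)
  · rw [add_comm m n]
    exact pow_mul_mem h.comm m (mul_map_mem h.comm b (map_mul_pow_sub_mem h.comm n a))

theorem hasLead_map_mul {n : ℕ} {t : S} {b : R} (a : R) (ht : HasLead ι y n t b) :
    HasLead ι y n (ι a * t) ((σ.symm ^ n) a * b) := by
  simpa using h.hasLead_mul (hasLead_map a) ht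

theorem hasLead_pow_mul {n : ℕ} {t : S} {b : R} (m : ℕ) (ht : HasLead ι y n t b) :
    HasLead ι y (m + n) (y ^ m * t) b := by
  simpa using h.hasLead_mul (hasLead_pow m) ht

end IsOreExtension

theorem symm_pow_apply_pow (σ : R ≃+* R) (n : ℕ) (r : R) : (σ.symm ^ n) ((σ ^ n) r) = r := by
  have : σ.symm = σ⁻¹ := rfl
  rw [this, inv_pow]
  exact (σ ^ n).symm_apply_apply r

end OreExtension

/-! ### Independent families of cyclic submodules -/

section Independence

variable (R : Type*) {M : Type*} [Ring R] [AddCommGroup M] [Module R M]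

/-- The sum of the cyclic submodules `R vᵢ`, for `i ∈ s`, is direct. -/
def IndepOn {α : Type*} (s : Finset α) (v : α → M) : Prop :=
  ∀ r : α → R, ∑ i ∈ s, r i • v i = 0 → ∀ i ∈ s, r i • v i = 0

/-- The module `M` contains no infinite direct sum of nonzero submodules. -/
def NoInfiniteSum (M : Type*) [AddCommGroup M] [Module R M] : Prop :=
  ∀ v : ℕ → M, (∀ s : Finset ℕ, IndepOn R s v) → ∃ n, v n = 0

variable {R}

theorem iSupIndep_span_of_indepOn {v : ℕ → M} (hv : ∀ s : Finset ℕ, IndepOn R s v) :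
    iSupIndep fun n => Submodule.span R {v n} := by
  classical
  rw [iSupIndep_iff_forall_dfinsupp]
  intro i x p hx
  have hmem : ∀ j, ∃ r : R, r • v j = ((p.erase i) j : M) := fun j =>
    Submodule.mem_span_singleton.1 ((p.erase i) j).2
  choose r hr using hmem
  obtain ⟨c, hc⟩ := Submodule.mem_span_singleton.1 x.2
  have hsum : (x : M) = ∑ j ∈ (p.erase i).support, r j • v j := by
    rw [← hx, DFinsupp.lsum_apply_apply, DFinsupp.sumAddHom_apply, DFinsupp.sum]
    exact Finset.sum_congr rfl fun j _ => (hr j).symm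
  have hi : i ∉ (p.erase i).support := by simp
  have key := hv (insert i (p.erase i).support) (fun j => if j = i then -c else r j) (by
    rw [Finset.sum_insert hi, if_pos rfl, neg_smul, hc, hsum, neg_add_eq_zero]
    refine Finset.sum_congr rfl fun j hj => ?_
    rw [if_neg]
    rintro rfl
    exact hi hj) i (Finset.mem_insert_self _ _)
  rw [if_pos rfl, neg_smul, neg_eq_zero, hc] at key
  exact Subtype.ext key

theorem indepOn_of_iSupIndep {α : Type*} {I : α → Submodule R M} (hI : iSupIndep I) {v : α → M}
    (hv : ∀ i, v i ∈ I i) (s : Finset α) : IndepOn R s v := by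
  classical
  intro r hr i hi
  rw [iSupIndep_def] at hI
  refine Submodule.disjoint_def.1 (hI i) _ (Submodule.smul_mem _ _ (hv i)) ?_
  rw [← Finset.add_sum_erase s _ hi, add_eq_zero_iff_eq_neg] at hr
  rw [hr]
  refine neg_mem (sum_mem fun j hj => ?_)
  exact Submodule.mem_iSup_of_mem j (Submodule.mem_iSup_of_mem (Finset.ne_of_mem_erase hj)
    (Submodule.smul_mem _ _ (hv j)))

/-- The elementwise form is the usable one, since leading coefficients belong to elements and not to
ideals. -/
theorem noInfiniteSum_iff :
    NoInfiniteSum R M ↔ ∀ I : ℕ → Submodule R M, iSupIndep I → ∃ n, I n = ⊥ := by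
  constructor
  · intro h I hI
    by_contra! hne
    choose v hv hv0 using fun n => (Submodule.ne_bot_iff _).1 (hne n)
    obtain ⟨n, hn⟩ := h v (indepOn_of_iSupIndep hI hv)
    exact hv0 n hn
  · intro h v hv
    obtain ⟨n, hn⟩ := h _ (iSupIndep_span_of_indepOn hv)
    exact ⟨n, Submodule.span_singleton_eq_bot.1 hn⟩

theorem noInfiniteSum_of_isNoetherian [IsNoetherian R M] : NoInfiniteSum R M := by
  rw [noInfiniteSum_iff]
  intro I hI
  by_contra! hne
  have := WellFoundedGT.finite_ne_bot_of_iSupIndep hI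
  refine Set.infinite_univ (α := ℕ) (this.subset fun n _ => hne n)

/-- A sequence is independent as soon as each term is independent of the subsequent ones. -/
theorem indepOn_of_descending {v : ℕ → M} {P : ℕ → Submodule R M} (hP : Antitone P)
    (hv : ∀ n, v n ∈ P n) (hd : ∀ n (r : R), r • v n ∈ P (n + 1) → r • v n = 0)
    (s : Finset ℕ) : IndepOn R s v := by
  intro r hr
  by_contra! hne
  classical
  have hex : ∃ i, i ∈ s ∧ r i • v i ≠ 0 := hne
  obtain ⟨his, hi0⟩ := Nat.find_spec hex
  set i := Nat.find hex
  apply hi0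
  apply hd
  rw [← Finset.add_sum_erase s _ his, add_eq_zero_iff_eq_neg] at hr
  rw [hr]
  refine neg_mem (sum_mem fun j hj => ?_)
  obtain ⟨hji, hjs⟩ := Finset.mem_erase.1 hj
  rcases lt_or_gt_of_ne hji with hlt | hgt
  · have := Nat.find_min hex hlt
    rw [not_and, not_not] at this
    rw [this hjs]
    exact zero_mem _
  · exact Submodule.smul_mem _ _ (hP hgt (hv j))

/-- A sequence is independent as soon as each term is independent of the preceding ones. -/
theorem indepOn_of_ascending {v : ℕ → M} {P : ℕ → Submodule R M} (hP : Monotone P)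
    (hv : ∀ n, v n ∈ P (n + 1)) (hd : ∀ n (r : R), r • v n ∈ P n → r • v n = 0)
    (s : Finset ℕ) : IndepOn R s v := by
  classical
  induction s using Finset.induction_on_max with
  | empty => intro r _ i hi; simp at hi
  | insert a s ha ih =>
    intro r hr
    have has : a ∉ s := fun h => lt_irrefl _ (ha a h)
    rw [Finset.sum_insert has] at hr
    have h0 : r a • v a = 0 := by
      apply hd
      rw [add_eq_zero_iff_eq_neg] at hr
      rw [hr]
      exact neg_mem (sum_mem fun j hj => Submodule.smul_mem _ _ (hP (ha j hj) (hv j)))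
    rw [h0, zero_add] at hr
    intro i hi
    rcases Finset.mem_insert.1 hi with rfl | hi
    · exact h0
    · exact ih r hr i hi

end Independence

/-! ### Transfer of domain, prime, noetherian and semiprime -/

section OreProperties

variable {R S : Type*} [Ring R] [Ring S] {ι : R →+* S} {y : S} {σ : R ≃+* R}

theorem IsSemiprimeRing.op {R : Type*} [Ring R] (h : IsSemiprimeRing R) :
    IsSemiprimeRing Rᵐᵒᵖ := by
  intro a ha
  apply MulOpposite.unop_injective
  apply h
  intro r
  have := congrArg MulOpposite.unop (ha (MulOpposite.op r))
  simpa [mul_assoc] using this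

theorem IsSemiprimeRing.of_op {R : Type*} [Ring R] (h : IsSemiprimeRing Rᵐᵒᵖ) :
    IsSemiprimeRing R := by
  intro a ha
  apply MulOpposite.op_injective
  apply h
  intro r
  apply MulOpposite.unop_injective
  simpa [mul_assoc] using ha r.unop

namespace IsOreExtension

variable (h : IsOreExtension ι σ y)
include h

theorem isDomain (hR : IsDomain R) : IsDomain S := by
  have : Nontrivial S := h.injective.nontrivial
  have : NoZeroDivisors S := by
    refine ⟨fun {s t} hst => ?_⟩
    by_contra! hne
    obtain ⟨m, a, ha, hs⟩ := h.exists_hasLead_ne_zero hne.1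
    obtain ⟨n, b, hb, ht⟩ := h.exists_hasLead_ne_zero hne.2
    have h0 := h.hasLead_mul hs ht
    rw [hst] at h0
    have h1 := h.hasLead_unique h0 (hasLead_zero_iff.2 (zero_mem _))
    rcases mul_eq_zero.1 h1 with h2 | h2
    · exact ha ((map_eq_zero_iff _ (σ.symm ^ n).injective).1 h2)
    · exact hb h2
  exact NoZeroDivisors.to_isDomain S

theorem isPrimeRing (hR : IsPrimeRing R) : IsPrimeRing S := by
  have : Nontrivial R := hR.1
  refine ⟨h.injective.nontrivial, fun s t hst => ?_⟩
  by_contra! hne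
  obtain ⟨m, a, ha, hs⟩ := h.exists_hasLead_ne_zero hne.1
  obtain ⟨n, b, hb, ht⟩ := h.exists_hasLead_ne_zero hne.2
  have key : ∀ r : R, (σ.symm ^ n) a * r * b = 0 := by
    intro r
    have h0 := h.hasLead_mul (h.hasLead_mul hs (hasLead_map ((σ ^ n) r))) ht
    rw [hst] at h0
    have h1 := h.hasLead_unique h0 (hasLead_zero_iff.2 (zero_mem _))
    rwa [map_mul, pow_zero, RingAut.one_apply, symm_pow_apply_pow] at h1
  rcases hR.2 _ _ key with h2 | h2
  · exact ha ((map_eq_zero_iff _ (σ.symm ^ n).injective).1 h2)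
  · exact hb h2

omit h in
/-- The left ideal of the coefficients at `yⁿ` of the elements of degree at most `n` of `L`. -/
def leadIdeal (h : IsOreExtension ι σ y) (L : Ideal S) (n : ℕ) : Ideal R where
  carrier := {r | ∃ s ∈ L, HasLead ι y n s r}
  add_mem' := by
    rintro a b ⟨s, hs, ha⟩ ⟨t, ht, hb⟩
    exact ⟨s + t, add_mem hs ht, ha.add hb⟩
  zero_mem' := ⟨0, zero_mem _, hasLead_zero_iff.2 (zero_mem _)⟩
  smul_mem' := by
    rintro c a ⟨s, hs, ha⟩
    refine ⟨ι ((σ ^ n) c) * s, L.mul_mem_left _ hs, ?_⟩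
    have := h.hasLead_map_mul ((σ ^ n) c) ha
    rwa [symm_pow_apply_pow] at this

/-- Left multiplication by a power of `y` leaves a coefficient written on the right unchanged. -/
theorem leadIdeal_mono {L L' : Ideal S} (hL : L ≤ L') {m n : ℕ} (hmn : m ≤ n) :
    h.leadIdeal L m ≤ h.leadIdeal L' n := by
  rintro r ⟨s, hs, hr⟩
  refine ⟨y ^ (n - m) * s, L'.mul_mem_left _ (hL hs), ?_⟩
  simpa [Nat.sub_add_cancel hmn] using h.hasLead_pow_mul (n - m) hr

/-- Subtracting an element of `L` with the same top coefficient lowers the degree, so induction on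
degree applies. -/
theorem le_of_leadIdeal_le {L L' : Ideal S} (hL : L ≤ L')
    (hle : ∀ n, h.leadIdeal L' n ≤ h.leadIdeal L n) : L' ≤ L := by
  intro s hs
  obtain ⟨n, hn⟩ := h.exhaust s
  induction n generalizing s with
  | zero => rw [mem_degreeLT_zero.1 hn]; exact zero_mem _
  | succ n ih =>
    obtain ⟨r, hr⟩ := h.exists_hasLead hn
    obtain ⟨t, ht, htr⟩ := hle n ⟨s, hs, hr⟩
    have h1 := hr.sub htr
    rw [sub_self, hasLead_zero_iff] at h1
    have h2 := add_mem (ih (sub_mem hs (hL ht)) h1) ht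
    rwa [sub_add_cancel] at h2

/-- Hilbert's basis theorem for Ore extensions. -/
theorem isNoetherianRing (hR : IsNoetherianRing R) : IsNoetherianRing S := by
  rw [isNoetherianRing_iff, ← monotone_stabilizes_iff_noetherian] at hR ⊢
  intro L
  -- The diagonal chain controls all degrees at least `N` at once; only the finitely many degrees
  -- below `N` need their own stabilization index.
  obtain ⟨N, hN⟩ := hR ⟨fun k => h.leadIdeal (L k) k, fun i j hij =>
    h.leadIdeal_mono (L.monotone hij) hij⟩
  have hstab : ∀ n, ∃ K, ∀ k, K ≤ k → h.leadIdeal (L K) n = h.leadIdeal (L k) n := fun n =>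
    hR ⟨fun k => h.leadIdeal (L k) n, fun i j hij => h.leadIdeal_mono (L.monotone hij) le_rfl⟩
  choose K hK using hstab
  refine ⟨N + ∑ i ∈ Finset.range N, K i, fun k hk => ?_⟩
  refine le_antisymm (L.monotone hk) (h.le_of_leadIdeal_le (L.monotone hk) fun n => ?_)
  rcases lt_or_ge n N with hn | hn
  · have hKn : K n ≤ N + ∑ i ∈ Finset.range N, K i :=
      (Finset.single_le_sum (fun i _ => Nat.zero_le (K i)) (Finset.mem_range.2 hn)).trans
        (Nat.le_add_left _ _)
    rw [← hK n k (hKn.trans hk)]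
    exact h.leadIdeal_mono (L.monotone hKn) le_rfl
  · have h1 : h.leadIdeal (L k) n ≤ h.leadIdeal (L (max k n)) (max k n) :=
      h.leadIdeal_mono (L.monotone (le_max_left _ _)) (le_max_right _ _)
    refine h1.trans ?_
    have h2 := hN (max k n) (hn.trans (le_max_right _ _))
    refine (le_of_eq h2.symm).trans ?_
    exact h.leadIdeal_mono (L.monotone (Nat.le_add_right _ _)) hn

/-- If `f S f = 0` and `f` has degree `n` with leading coefficient `a`, then `σ⁻ᵐ(a) R a = 0` for
all `m ≥ n`. The translates `σ^(-(n+1)i)(a)` differ by shifts of at least `n`, so distinct ones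
annihilate each other through `R`, in both orders by semiprimeness. They therefore form an infinite
independent family unless `a = 0`. -/
theorem isSemiprimeRing (hR : IsSemiprimeRing R) (hfin : NoInfiniteSum R R) :
    IsSemiprimeRing S := by
  intro f hf
  by_contra hne
  obtain ⟨n, a, ha, hlead⟩ := h.exists_hasLead_ne_zero hne
  have hzero : ∀ k r, (σ.symm ^ (n + k)) a * r * a = 0 := by
    intro k r
    have h0 := h.hasLead_mul (h.hasLead_mul hlead
      (h.hasLead_mul (hasLead_pow k) (hasLead_map ((σ ^ n) r)))) hlead
    rw [hf] at h0
    have h1 := h.hasLead_unique h0 (hasLead_zero_iff.2 (zero_mem _))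
    rw [map_one, one_mul, add_zero, map_mul, symm_pow_apply_pow] at h1
    rw [pow_add]
    exact h1
  have hlt : ∀ i j, j < i → ∀ r,
      (σ.symm ^ ((n + 1) * i)) a * r * (σ.symm ^ ((n + 1) * j)) a = 0 := by
    intro i j hij r
    obtain ⟨k, rfl⟩ : ∃ k, i = j + 1 + k := ⟨i - (j + 1), by omega⟩
    have e : (n + 1) * (j + 1 + k) = (n + 1) * j + (n + (1 + (n + 1) * k)) := by ring
    have h1 := congrArg (σ.symm ^ ((n + 1) * j))
      (hzero (1 + (n + 1) * k) ((σ ^ ((n + 1) * j)) r))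
    rw [map_mul, map_mul, symm_pow_apply_pow, map_zero] at h1
    rw [e, pow_add]
    exact h1
  have hgt : ∀ i j, i < j → ∀ r,
      (σ.symm ^ ((n + 1) * i)) a * r * (σ.symm ^ ((n + 1) * j)) a = 0 := by
    intro i j hij r
    apply hR
    intro t
    have h1 := hlt j i hij t
    set b := (σ.symm ^ ((n + 1) * i)) a
    set c := (σ.symm ^ ((n + 1) * j)) a
    calc b * r * c * t * (b * r * c) = b * r * (c * t * b) * (r * c) := by noncomm_ring
      _ = 0 := by rw [h1]; simp
  obtain ⟨m, hm⟩ := hfin (fun i => (σ.symm ^ ((n + 1) * i)) a) (by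
    intro s r hr i hi
    apply hR
    intro t
    -- This right factor kills every summand but the `i`-th and leaves `x t x = 0`, where `x` is the
    -- `i`-th summand.
    have h1 := congrArg (fun x => x * (t * r i * (σ.symm ^ ((n + 1) * i)) a)) hr
    simp only [Finset.sum_mul, zero_mul] at h1
    rw [Finset.sum_eq_single_of_mem i hi] at h1
    · simpa [mul_assoc] using h1
    · intro j _ hji
      have h2 : (σ.symm ^ ((n + 1) * j)) a * (t * r i) * (σ.symm ^ ((n + 1) * i)) a = 0 := by
        rcases lt_or_gt_of_ne hji with hlt' | hgt'
        · exact hgt _ _ hlt' _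
        · exact hlt _ _ hgt' _
      rw [smul_eq_mul, mul_assoc, ← mul_assoc _ (t * r i), h2, mul_zero])
  exact ha ((map_eq_zero_iff _ (σ.symm ^ ((n + 1) * m)).injective).1 hm)

end IsOreExtension

end OreProperties

/-! ### Uniform dimension -/

section Rank

variable {R M : Type*} [Ring R] [AddCommGroup M] [Module R M]

/-- Every direct sum of nonzero cyclic submodules of `(P + N) / N` has at most `n` summands. -/
def RankLE (N P : Submodule R M) (n : ℕ) : Prop :=
  ∀ (α : Type) (s : Finset α) (v : α → M), (∀ i ∈ s, v i ∈ P) → (∀ i ∈ s, v i ∉ N) →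
    (∀ r : α → R, ∑ i ∈ s, r i • v i ∈ N → ∀ i ∈ s, r i • v i ∈ N) → s.card ≤ n

theorem rankLE_bot_iff {P : Submodule R M} {n : ℕ} : RankLE ⊥ P n ↔
    ∀ (α : Type) (s : Finset α) (v : α → M), (∀ i ∈ s, v i ∈ P) → (∀ i ∈ s, v i ≠ 0) →
      IndepOn R s v → s.card ≤ n := Iff.rfl

/-- Take a largest subfamily `T` that stays independent modulo `P`; it has at most `b` members. By
maximality each remaining `v j` has a nonzero multiple that lies in `P` after adding a combination
from `T`, and these corrected elements are independent in `P`. -/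
theorem RankLE.add {P Q : Submodule R M} {a b : ℕ} (hP : RankLE ⊥ P a) (hQ : RankLE P Q b) :
    RankLE ⊥ Q (a + b) := by
  classical
  rw [rankLE_bot_iff] at hP ⊢
  intro α s v hv hv0 hind
  let good : Finset α → Prop := fun T =>
    ∀ r : α → R, ∑ i ∈ T, r i • v i ∈ P → ∀ i ∈ T, r i • v i = 0
  obtain ⟨T, hT, hmax⟩ := Finset.exists_max_image (s.powerset.filter good) Finset.card
    ⟨∅, by simp [good]⟩
  obtain ⟨hTs, hTgood⟩ := Finset.mem_filter.1 hT
  rw [Finset.mem_powerset] at hTs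
  have hTcard : T.card ≤ b := by
    refine hQ α T v (fun i hi => hv i (hTs hi)) (fun i hi hiP => ?_) fun r hr i hi => ?_
    · apply hv0 i (hTs hi)
      have := hTgood (fun j => if j = i then 1 else 0) (by simpa [hi] using hiP) i hi
      simpa using this
    · rw [hTgood r hr i hi]
      exact zero_mem _
  have hex : ∀ j, ∃ r : α → R, j ∈ s \ T →
      r j • v j + ∑ i ∈ T, r i • v i ∈ P ∧ r j • v j ≠ 0 := by
    intro j
    by_cases hj : j ∈ s \ T
    · obtain ⟨hjs, hjT⟩ := Finset.mem_sdiff.1 hj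
      have hbad : ¬ good (insert j T) := by
        intro hg
        have := hmax (insert j T) (Finset.mem_filter.2 ⟨Finset.mem_powerset.2
          (Finset.insert_subset hjs hTs), hg⟩)
        rw [Finset.card_insert_of_notMem hjT] at this
        omega
      simp only [good, not_forall] at hbad
      obtain ⟨r, hr, i, hi, hne⟩ := hbad
      rw [Finset.sum_insert hjT] at hr
      refine ⟨r, fun _ => ⟨hr, fun h0 => ?_⟩⟩
      rw [h0, zero_add] at hr
      rcases Finset.mem_insert.1 hi with rfl | hiT
      · exact hne h0
      · exact hne (hTgood r hr i hiT)
    · exact ⟨0, fun h => absurd h hj⟩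
  choose r hr using hex
  let w : α → M := fun j => r j j • v j + ∑ i ∈ T, r j i • v i
  have hzero : ∀ c : α → R, ∑ j ∈ s \ T, c j • w j = 0 →
      ∀ j ∈ s \ T, c j • r j j • v j = 0 := by
    intro c hc j hj
    have h1 := hind (fun i => if i ∈ T then ∑ j ∈ s \ T, c j * r j i else c i * r i i) (by
      rw [← Finset.sum_sdiff hTs, ← hc]
      simp only [w, smul_add, Finset.sum_add_distrib, Finset.smul_sum]
      congr 1
      · refine Finset.sum_congr rfl fun i hi => ?_
        rw [if_neg (Finset.mem_sdiff.1 hi).2, mul_smul]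
      · rw [Finset.sum_comm]
        refine Finset.sum_congr rfl fun i hi => ?_
        rw [if_pos hi, Finset.sum_smul]
        exact Finset.sum_congr rfl fun k _ => mul_smul _ _ _) j (Finset.mem_sdiff.1 hj).1
    rwa [if_neg (Finset.mem_sdiff.1 hj).2, mul_smul] at h1
  have hcompl : (s \ T).card ≤ a := by
    refine hP α (s \ T) w (fun j hj => (hr j hj).1) (fun j hj h0 => ?_) fun c hc j hj => ?_
    · refine (hr j hj).2 ?_
      have := hzero (fun i => if i = j then 1 else 0) (by simp [h0]) j hj
      simpa using this
    · have hmem : c j • w j ∈ P := P.smul_mem _ (hr j hj).1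
      have h1 := hzero c hc j hj
      simp only [w, smul_add, h1, zero_add, Finset.smul_sum, ← mul_smul] at hmem ⊢
      exact Finset.sum_eq_zero (hTgood _ hmem)
  have := Finset.card_sdiff_add_card_eq_card hTs
  omega

theorem rankLE_of_chain {F : ℕ → Submodule R M} {u : ℕ} (h0 : F 0 = ⊥)
    (hF : ∀ n, RankLE (F n) (F (n + 1)) u) (n : ℕ) : RankLE ⊥ (F n) (n * u) := by
  induction n with
  | zero =>
    intro α s v hv hv0 _
    rw [h0] at hv
    simp only [zero_mul, nonpos_iff_eq_zero, Finset.card_eq_zero]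
    exact Finset.eq_empty_of_forall_notMem fun i hi => hv0 i hi (hv i hi)
  | succ n ih =>
    rw [add_mul, one_mul]
    exact ih.add (hF n)

/-- Modulo `X`, each element may be replaced by its component in `Y`. -/
theorem RankLE.sup {X Y : Submodule R M} {n : ℕ} (hXY : Disjoint X Y) (hY : RankLE ⊥ Y n) :
    RankLE X (X ⊔ Y) n := by
  intro α s v hv hvX hind
  have hex : ∀ i, ∃ b ∈ Y, i ∈ s → v i - b ∈ X := by
    intro i
    by_cases hi : i ∈ s
    · obtain ⟨x, hx, b, hb, hxb⟩ := Submodule.mem_sup.1 (hv i hi)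
      exact ⟨b, hb, fun _ => by rwa [← hxb, add_sub_cancel_right]⟩
    · exact ⟨0, zero_mem _, fun h => absurd h hi⟩
  choose b hbY hbX using hex
  refine hY α s b (fun i _ => hbY i) (fun i hi h0 => hvX i hi ?_) fun r hr i hi => ?_
  · have := hbX i hi
    rwa [(Submodule.mem_bot R).1 h0, sub_zero] at this
  · rw [Submodule.mem_bot] at hr ⊢
    have hsum : ∑ i ∈ s, r i • v i ∈ X := by
      have : ∑ i ∈ s, r i • (v i - b i) ∈ X := sum_mem fun i hi => X.smul_mem _ (hbX i hi)
      simpa only [smul_sub, Finset.sum_sub_distrib, hr, sub_zero] using this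
    refine Submodule.disjoint_def.1 hXY _ ?_ (Y.smul_mem _ (hbY i))
    have := sub_mem (hind r hsum i hi) (X.smul_mem (r i) (hbX i hi))
    rwa [smul_sub, sub_sub_cancel] at this

theorem RankLE.of_essential {P Q : Submodule R M} {n : ℕ} (hQ : RankLE ⊥ Q n)
    (hess : ∀ m ∈ P, m ≠ 0 → ∃ t : R, t • m ≠ 0 ∧ t • m ∈ Q) : RankLE ⊥ P n := by
  rw [rankLE_bot_iff] at hQ ⊢
  intro α s v hv hv0 hind
  have hex : ∀ i, ∃ t : R, i ∈ s → t • v i ≠ 0 ∧ t • v i ∈ Q := by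
    intro i
    by_cases hi : i ∈ s
    · obtain ⟨t, ht⟩ := hess _ (hv i hi) (hv0 i hi)
      exact ⟨t, fun _ => ht⟩
    · exact ⟨0, fun h => absurd h hi⟩
  choose t ht using hex
  refine hQ α s (fun i => t i • v i) (fun i hi => (ht i hi).2) (fun i hi => (ht i hi).1) ?_
  intro r hr
  simp only [← mul_smul] at hr ⊢
  exact hind _ hr

/-- Inside `P`, a submodule `X` has a complement `Y`, in the sense that `X ⊕ Y` is essential. -/
theorem exists_disjoint_essential (X P : Submodule R M) : ∃ Y ≤ P, Disjoint X Y ∧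
    ∀ m ∈ P, m ≠ 0 → ∃ t : R, t • m ≠ 0 ∧ t • m ∈ X ⊔ Y := by
  obtain ⟨Y, hY⟩ := zorn_le₀ {Y : Submodule R M | Y ≤ P ∧ Disjoint X Y} (by
    intro c hc hchain
    refine ⟨sSup c, ⟨sSup_le fun Y hY => (hc hY).1, ?_⟩, fun Y hY => le_sSup hY⟩
    exact hchain.directedOn.disjoint_sSup_right.2 fun Y hY => (hc hY).2)
  refine ⟨Y, hY.prop.1, hY.prop.2, fun m hm hm0 => ?_⟩
  by_contra! hne
  have hmem : Y ⊔ Submodule.span R {m} ∈ {Y : Submodule R M | Y ≤ P ∧ Disjoint X Y} := by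
    refine ⟨sup_le hY.prop.1 ((Submodule.span_singleton_le_iff_mem _ _).2 hm), ?_⟩
    rw [Submodule.disjoint_def]
    intro x hx hx'
    obtain ⟨z, hz, w, hw, rfl⟩ := Submodule.mem_sup.1 hx'
    obtain ⟨t, rfl⟩ := Submodule.mem_span_singleton.1 hw
    have htm : t • m = 0 := by
      by_contra h0
      apply hne t h0
      have := sub_mem (Submodule.mem_sup_left (T := Y) hx) (Submodule.mem_sup_right (S := X) hz)
      rwa [add_sub_cancel_left] at this
    rw [htm, add_zero] at hx ⊢
    exact Submodule.disjoint_def.1 hY.prop.2 z hx hz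
  have hle := hY.le_of_ge hmem le_sup_left
  have hmY : m ∈ Y := hle (Submodule.mem_sup_right (Submodule.mem_span_singleton_self m))
  exact hne 1 (by rwa [one_smul]) (by rw [one_smul]; exact Submodule.mem_sup_right hmY)

/-- Take two independent elements of `P` and an essential complement `Y` of the span of the first.
Ranks add, so that span and `Y` cannot both have finite rank: split off the first element against
`Y`, or the second against the span of the first. Iterating produces an infinite independent
sequence. -/
theorem exists_split_of_infinite_rank {P : Submodule R M} (hP : ¬ ∃ n, RankLE ⊥ P n) :
    ∃ x ∈ P, ∃ Q ≤ P, x ≠ 0 ∧ (∀ r : R, r • x ∈ Q → r • x = 0) ∧ ¬ ∃ n, RankLE ⊥ Q n := by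
  have h1 : ¬ RankLE ⊥ P 1 := fun h => hP ⟨1, h⟩
  rw [rankLE_bot_iff] at h1
  push Not at h1
  obtain ⟨α, s, v, hv, hv0, hind, hs⟩ := h1
  obtain ⟨i, hi, j, hj, hij⟩ := Finset.one_lt_card.1 hs
  obtain ⟨Y, hYP, hdisj, hess⟩ := exists_disjoint_essential (Submodule.span R {v i}) P
  by_cases hY : ∃ n, RankLE ⊥ Y n
  · refine ⟨v j, hv j hj, Submodule.span R {v i},
      (Submodule.span_singleton_le_iff_mem _ _).2 (hv i hi), hv0 j hj, fun r hr => ?_, ?_⟩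
    · classical
      obtain ⟨t, ht⟩ := Submodule.mem_span_singleton.1 hr
      have := hind (fun k => if k = i then t else if k = j then -r else 0) (by
        rw [← Finset.add_sum_erase s _ hi,
          ← Finset.add_sum_erase _ _ (Finset.mem_erase.2 ⟨hij.symm, hj⟩)]
        rw [Finset.sum_eq_zero]
        · simp [hij.symm, ht]
        · intro k hk
          simp only [Finset.mem_erase] at hk
          simp [hk.1, hk.2.1]) j hj
      simpa [hij.symm] using this
    · rintro ⟨a, ha⟩
      obtain ⟨b, hb⟩ := hY
      exact hP ⟨a + b, (ha.add (hb.sup hdisj)).of_essential hess⟩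
  · refine ⟨v i, hv i hi, Y, hYP, hv0 i hi, fun r hr => ?_, hY⟩
    exact Submodule.disjoint_def.1 hdisj _
      (Submodule.smul_mem _ _ (Submodule.mem_span_singleton_self _)) hr

/-- A module without infinite direct sums of submodules has finite rank. -/
theorem exists_rankLE_of_noInfiniteSum (h : NoInfiniteSum R M) :
    ∃ n, RankLE (⊥ : Submodule R M) ⊤ n := by
  by_contra hinf
  let T := {P : Submodule R M // ¬ ∃ n, RankLE ⊥ P n}
  choose x hx Q hQ hx0 hxQ hQinf using fun P : T => exists_split_of_infinite_rank P.2
  let P : ℕ → T := fun n => Nat.rec ⟨⊤, hinf⟩ (fun _ P => ⟨Q P, hQinf P⟩) n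
  have hanti : Antitone fun n => (P n).1 := antitone_nat_of_succ_le fun n => hQ (P n)
  obtain ⟨n, hn⟩ := h (fun n => x (P n))
    (indepOn_of_descending hanti (fun n => hx (P n)) fun n r hr => hxQ (P n) r hr)
  exact hx0 _ hn

end Rank

/-! ### Nonsingular rings and the chain condition on annihilators -/

section Nonsingular

/-- The left singular ideal of `R` is zero. -/
def IsLeftNonsingular (R : Type*) [Ring R] : Prop :=
  ∀ a : R, (∀ r : R, r ≠ 0 → ∃ t : R, t * r ≠ 0 ∧ t * r * a = 0) → a = 0

variable {R : Type*} [Ring R]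

theorem mem_leftAnnihilator {S : Set R} {r : R} :
    r ∈ leftAnnihilator S ↔ ∀ s ∈ S, r * s = 0 := Iff.rfl

/-- Among nonzero singular elements choose `a` with maximal left annihilator. If `a r a ≠ 0`, it is
again singular, and some `t` kills `a r a` while `t a r ≠ 0`, so the annihilator grows strictly.
Hence `a R a = 0`. -/
theorem isLeftNonsingular_of_isSemiprimeRing (hR : IsSemiprimeRing R)
    (hacc : WellFoundedGT (Set.range (leftAnnihilator : Set R → Ideal R))) :
    IsLeftNonsingular R := by
  by_contra hne
  simp only [IsLeftNonsingular, not_forall] at hne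
  obtain ⟨a₀, ha₀, ha₀0⟩ := hne
  let f : R → Set.range (leftAnnihilator : Set R → Ideal R) := fun a => ⟨leftAnnihilator {a}, _, rfl⟩
  obtain ⟨a, ⟨ha0, ha⟩, hmax⟩ := (InvImage.wf f hacc.wf).has_min
    {a : R | a ≠ 0 ∧ ∀ r : R, r ≠ 0 → ∃ t : R, t * r ≠ 0 ∧ t * r * a = 0} ⟨a₀, ha₀0, ha₀⟩
  apply ha0
  apply hR
  intro r
  by_contra hara
  refine hmax (a * r * a) ⟨hara, fun s hs => ?_⟩ ?_
  · obtain ⟨t, ht, hta⟩ := ha s hs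
    exact ⟨t, ht, by rw [mul_assoc a, ← mul_assoc, hta, zero_mul]⟩
  · have har : a * r ≠ 0 := fun h0 => hara (by rw [h0, zero_mul])
    obtain ⟨t, ht, hta⟩ := ha _ har
    refine lt_of_le_of_ne ?_ ?_
    · intro x hx
      rw [mem_leftAnnihilator] at hx ⊢
      rintro _ rfl
      rw [mul_assoc a, ← mul_assoc, hx a rfl, zero_mul]
    · intro heq
      have htm : t ∈ leftAnnihilator {a * r * a} := by
        rw [mem_leftAnnihilator]
        rintro _ rfl
        rw [← mul_assoc, hta]
      have heq' : leftAnnihilator {a} = leftAnnihilator {a * r * a} := congrArg Subtype.val heq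
      rw [← heq', mem_leftAnnihilator] at htm
      exact ht (by rw [← mul_assoc, htm a rfl, zero_mul])

/-- In a nonsingular ring an annihilator is never essential in a strictly larger one: for `b` in the
larger, each `b s` with `s` in the annihilated set would be singular. A strictly ascending chain
thus yields an infinite independent sequence. -/
theorem IsLeftNonsingular.wellFoundedGT_leftAnnihilator (hR : IsLeftNonsingular R)
    (hfin : NoInfiniteSum R R) :
    WellFoundedGT (Set.range (leftAnnihilator : Set R → Ideal R)) := by
  refine ⟨?_⟩
  rw [RelEmbedding.wellFounded_iff_isEmpty]
  refine ⟨fun f => ?_⟩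
  have hlt : ∀ m n, m < n → (f m).1 < (f n).1 := fun m n hmn => f.map_rel_iff.2 hmn
  have hex : ∀ n, ∃ v ∈ (f (n + 1)).1, v ≠ 0 ∧ ∀ r : R, r • v ∈ (f n).1 → r • v = 0 := by
    intro n
    by_contra! hne
    obtain ⟨b, hb, hbn⟩ := SetLike.exists_of_lt (hlt n (n + 1) n.lt_succ_self)
    obtain ⟨T, hT⟩ := (f n).2
    apply hbn
    rw [← hT, mem_leftAnnihilator]
    intro s hs
    apply hR
    intro r hr
    by_cases hrb : r * b = 0
    · exact ⟨1, by rwa [one_mul], by rw [one_mul, ← mul_assoc, hrb, zero_mul]⟩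
    · obtain ⟨t, ht, ht0⟩ := hne (r * b) (Ideal.mul_mem_left _ _ hb) hrb
      rw [smul_eq_mul, ← mul_assoc] at ht ht0
      refine ⟨t, fun h0 => ht0 (by rw [h0, zero_mul]), ?_⟩
      rw [← hT, mem_leftAnnihilator] at ht
      rw [← mul_assoc, ht s hs]
  choose v hv hv0 hvd using hex
  have hmono : Monotone fun n => (f n).1 := monotone_nat_of_le_succ fun n =>
    (hlt n (n + 1) n.lt_succ_self).le
  obtain ⟨n, hn⟩ := hfin v (indepOn_of_ascending hmono hv hvd)
  exact hv0 n hn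

end Nonsingular

/-! ### Transfer of the Goldie conditions -/

section OreGoldie

variable {R S : Type*} [Ring R] [Ring S] {ι : R →+* S} {y : S} {σ : R ≃+* R}

namespace IsOreExtension

variable (h : IsOreExtension ι σ y)
include h

/-- The top coefficient of `s` may be killed by `r`; such terms can be removed from `s` without
changing `s * ι r`. -/
theorem exists_hasLead_mul_map {s : S} {r : R} (hs : s * ι r ≠ 0) :
    ∃ n c, c * r ≠ 0 ∧ HasLead ι y n (s * ι r) (c * r) := by
  obtain ⟨n, hn⟩ := h.exhaust s
  induction n generalizing s with
  | zero => exact absurd (by rw [mem_degreeLT_zero.1 hn, zero_mul]) hs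
  | succ n ih =>
    obtain ⟨c, hc⟩ := h.exists_hasLead hn
    by_cases h0 : c * r = 0
    · have e : s * ι r = (s - y ^ n * ι c) * ι r := by
        rw [sub_mul, mul_assoc (y ^ n), ← map_mul, h0, map_zero, mul_zero, sub_zero]
      rw [e] at hs ⊢
      exact ih hs hc
    · refine ⟨n, c, h0, ?_⟩
      simpa using h.hasLead_mul hc (hasLead_map r)

theorem isLeftNonsingular (hR : IsLeftNonsingular R) : IsLeftNonsingular S := by
  intro f hf
  by_contra hne
  obtain ⟨n, a, ha, hlead⟩ := h.exists_hasLead_ne_zero hne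
  apply ha
  apply hR
  intro r hr
  have hr' : ι ((σ ^ n) r) ≠ 0 := by
    rw [Ne, map_eq_zero_iff ι h.injective, map_eq_zero_iff _ (σ ^ n).injective]
    exact hr
  obtain ⟨t, ht, htf⟩ := hf _ hr'
  obtain ⟨m, c, hc, hlt⟩ := h.exists_hasLead_mul_map ht
  have h0 := h.hasLead_mul hlt hlead
  rw [htf] at h0
  have h1 := h.hasLead_unique h0 (hasLead_zero_iff.2 (zero_mem _))
  rw [map_mul, symm_pow_apply_pow] at h1
  refine ⟨(σ.symm ^ n) c, fun h2 => hc ?_, h1⟩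
  rw [← map_eq_zero_iff _ (σ.symm ^ n).injective, map_mul, symm_pow_apply_pow, h2]

/-- Over a nonsingular ring, the left ideal generated by `f` contains in each large degree a
multiple of `f` whose coefficient multiples do not drop in degree. -/
theorem exists_mul_degree_stable (hR : IsLeftNonsingular R) {f : S} {d : ℕ} {a : R} (ha : a ≠ 0)
    (hf : HasLead ι y d f a) {j : ℕ} (hj : d ≤ j) :
    ∃ s : S, s * f ≠ 0 ∧ s * f ∈ degreeLT ι y (j + 1) ∧
      ∀ c, ι c * (s * f) ∈ degreeLT ι y j → ι c * (s * f) = 0 := by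
  have hns := mt (hR a) ha
  push Not at hns
  -- Right multiplication by `a` is injective on `R r`, so a multiple of `r a` vanishes only when
  -- that multiple of `r` already does.
  obtain ⟨r, hr, hra⟩ := hns
  have hlead : HasLead ι y j (ι ((σ ^ j) r) * y ^ (j - d) * f) (r * a) := by
    have h1 := h.hasLead_pow_mul (j - d) hf
    rw [Nat.sub_add_cancel hj] at h1
    have h2 := h.hasLead_map_mul ((σ ^ j) r) h1
    rwa [symm_pow_apply_pow, ← mul_assoc] at h2
  refine ⟨ι ((σ ^ j) r) * y ^ (j - d), fun h0 => ?_, h.mem_of_hasLead hlead, fun c hc => ?_⟩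
  · rw [h0] at hlead
    have h1 := h.hasLead_unique hlead (hasLead_zero_iff.2 (zero_mem _))
    exact hra 1 (by rwa [one_mul]) (by rwa [one_mul])
  · have h1 := h.hasLead_unique (h.hasLead_map_mul c hlead) (hasLead_zero_iff.2 hc)
    rw [← mul_assoc] at h1
    have h2 : (σ.symm ^ j) c * r = 0 := by
      by_contra h3
      exact hra _ h3 h1
    have h4 : c * (σ ^ j) r = 0 := by
      rw [← map_eq_zero_iff _ (σ.symm ^ j).injective, map_mul, symm_pow_apply_pow, h2]
    rw [← mul_assoc, ← mul_assoc, ← map_mul, h4]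
    simp

/-- A growth count over `R`. If `R` has rank at most `u`, elements of degree less than `n` have rank
at most `n u`. Each nonzero left ideal contributes one independent element in every large degree, so
`u + 1` independent left ideals outgrow this bound. -/
theorem noInfiniteSum (hR : IsLeftNonsingular R) (hfin : NoInfiniteSum R R) :
    NoInfiniteSum S S := by
  classical
  let _ : Module R S := Module.compHom S ι
  have hsmul : ∀ (r : R) (s : S), r • s = ι r * s := fun _ _ => rfl
  let F : ℕ → Submodule R S := fun n =>
    { degreeLT ι y n with smul_mem' := fun r s hs => map_mul_mem r hs }
  have hFmem : ∀ n s, s ∈ F n ↔ s ∈ degreeLT ι y n := fun _ _ => Iff.rfl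
  obtain ⟨u, hu⟩ := exists_rankLE_of_noInfiniteSum hfin
  -- The top coefficient embeds each graded piece into `R`, semilinearly with respect to `σ⁻ⁿ`, so
  -- independence carries over.
  have hF : ∀ n, RankLE (F n) (F (n + 1)) u := by
    intro n α s v hv hv0 hind
    have hex : ∀ i, ∃ a, i ∈ s → HasLead ι y n (v i) a := by
      intro i
      by_cases hi : i ∈ s
      · obtain ⟨a, ha⟩ := h.exists_hasLead (hv i hi)
        exact ⟨a, fun _ => ha⟩
      · exact ⟨0, fun h => absurd h hi⟩
    choose a ha using hex
    refine rankLE_bot_iff.1 hu α s a (fun i _ => Submodule.mem_top) (fun i hi h0 => ?_)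
      fun r hr i hi => ?_
    · have := ha i hi
      rw [h0, hasLead_zero_iff] at this
      exact hv0 i hi this
    · have hlead : ∀ i ∈ s, HasLead ι y n ((σ ^ n) (r i) • v i) (r i * a i) := by
        intro i hi
        have := h.hasLead_map_mul ((σ ^ n) (r i)) (ha i hi)
        rwa [symm_pow_apply_pow] at this
      have hsum := HasLead.sum s hlead
      simp only [smul_eq_mul] at hr
      rw [hr, hasLead_zero_iff] at hsum
      have h1 := hind (fun i => (σ ^ n) (r i)) hsum i hi
      exact h.hasLead_unique (hlead i hi) (hasLead_zero_iff.2 h1)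
  have hrank := rankLE_of_chain (F := F) (by ext s; rfl) hF
  intro v hv
  by_contra! hne
  choose d a ha hlead using fun n => h.exists_hasLead_ne_zero (hne n)
  let D := ∑ i ∈ Finset.range (u + 1), d i
  have hD : ∀ i ∈ Finset.range (u + 1), d i ≤ D := fun i hi =>
    Finset.single_le_sum (fun i _ => Nat.zero_le (d i)) hi
  have hex : ∀ i j, ∃ s : S, i ∈ Finset.range (u + 1) →
      s * v i ≠ 0 ∧ s * v i ∈ degreeLT ι y (D + j + 1) ∧
        ∀ c, ι c * (s * v i) ∈ degreeLT ι y (D + j) → ι c * (s * v i) = 0 := by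
    intro i j
    by_cases hi : i ∈ Finset.range (u + 1)
    · obtain ⟨s, hs⟩ := h.exists_mul_degree_stable hR (ha i) (hlead i)
        ((hD i hi).trans (Nat.le_add_right D j))
      exact ⟨s, fun _ => hs⟩
    · exact ⟨0, fun h => absurd h hi⟩
  choose s hs using hex
  -- The least `m` for which `(u + 1) m` exceeds the bound `(D + m) u`.
  let m := D * u + 1
  have hcard := rankLE_bot_iff.1 (hrank (D + m)) (ℕ × ℕ)
    (Finset.range (u + 1) ×ˢ Finset.range m) (fun p => s p.1 p.2 * v p.1) (by
      rintro ⟨i, j⟩ hij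
      obtain ⟨hi, hj⟩ := Finset.mem_product.1 hij
      exact degreeLT_mono (by have := Finset.mem_range.1 hj; dsimp at this; omega) (hs i j hi).2.1)
    (by
      rintro ⟨i, j⟩ hij
      exact (hs i j (Finset.mem_product.1 hij).1).1)
    (by
      rintro r hr ⟨i, j⟩ hij
      obtain ⟨hi, hj⟩ := Finset.mem_product.1 hij
      rw [Finset.sum_product] at hr
      have h1 := hv (Finset.range (u + 1))
        (fun i => ∑ j ∈ Finset.range m, ι (r (i, j)) * s i j) (by
          rw [← hr]
          refine Finset.sum_congr rfl fun i _ => ?_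
          rw [smul_eq_mul, Finset.sum_mul]
          exact Finset.sum_congr rfl fun j _ => mul_assoc _ _ _) i hi
      refine indepOn_of_ascending (P := fun j => F (D + j)) (v := fun j => s i j * v i)
        (fun j k hjk => degreeLT_mono (by omega)) (fun j => (hs i j hi).2.1)
        (fun j c hc => (hs i j hi).2.2 c hc) (Finset.range m) (fun j => r (i, j)) ?_ j hj
      rw [← h1, smul_eq_mul, Finset.sum_mul]
      exact Finset.sum_congr rfl fun j _ => (mul_assoc _ _ _).symm)
  rw [Finset.card_product, Finset.card_range, Finset.card_range] at hcard
  have : (u + 1) * m = (D + m) * u + 1 := by simp only [m]; ring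
  omega

theorem isLeftGoldie (hR : IsSemiprimeRing R) (hG : IsLeftGoldie R) : IsLeftGoldie S := by
  have hfin := noInfiniteSum_iff.2 hG.no_infinite_direct_sum
  have hns := isLeftNonsingular_of_isSemiprimeRing hR hG.acc_annihilators
  have hfinS := h.noInfiniteSum hns hfin
  exact ⟨(h.isLeftNonsingular hns).wellFoundedGT_leftAnnihilator hfinS,
    noInfiniteSum_iff.1 hfinS⟩

end IsOreExtension

/-- The properties listed in the transfer theorem hold for `S` as soon as they hold for `R`. -/
def TransfersTo (R S : Type*) [Ring R] [Ring S] : Prop :=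
  (IsLeftNoetherian R → IsLeftNoetherian S) ∧
  (IsRightNoetherian R → IsRightNoetherian S) ∧
  (IsDomain R → IsDomain S) ∧
  (IsPrimeRing R → IsPrimeRing S) ∧
  (IsSemiprimeRing R ∧ IsLeftNoetherian R → IsSemiprimeRing S ∧ IsLeftNoetherian S) ∧
  (IsSemiprimeRing R ∧ IsRightNoetherian R → IsSemiprimeRing S ∧ IsRightNoetherian S) ∧
  (IsSemiprimeRing R ∧ IsLeftGoldie R → IsSemiprimeRing S ∧ IsLeftGoldie S) ∧
  (IsSemiprimeRing R ∧ IsRightGoldie R → IsSemiprimeRing S ∧ IsRightGoldie S)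

theorem TransfersTo.trans {R S T : Type*} [Ring R] [Ring S] [Ring T] (h₁ : TransfersTo R S)
    (h₂ : TransfersTo S T) : TransfersTo R T := by
  obtain ⟨a₁, b₁, c₁, d₁, e₁, f₁, g₁, i₁⟩ := h₁
  obtain ⟨a₂, b₂, c₂, d₂, e₂, f₂, g₂, i₂⟩ := h₂
  exact ⟨a₂ ∘ a₁, b₂ ∘ b₁, c₂ ∘ c₁, d₂ ∘ d₁, e₂ ∘ e₁, f₂ ∘ f₁, g₂ ∘ g₁, i₂ ∘ i₁⟩

theorem IsOreExtension.transfersTo (h : IsOreExtension ι σ y) : TransfersTo R S := by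
  refine ⟨h.isNoetherianRing, h.op.isNoetherianRing, h.isDomain, h.isPrimeRing, ?_, ?_, ?_, ?_⟩
  · rintro ⟨hs, hn⟩
    have : IsNoetherian R R := hn
    exact ⟨h.isSemiprimeRing hs noInfiniteSum_of_isNoetherian, h.isNoetherianRing hn⟩
  · rintro ⟨hs, hn⟩
    have : IsNoetherian Rᵐᵒᵖ Rᵐᵒᵖ := hn
    exact ⟨(h.op.isSemiprimeRing hs.op noInfiniteSum_of_isNoetherian).of_op,
      h.op.isNoetherianRing hn⟩
  · rintro ⟨hs, hg⟩
    exact ⟨h.isSemiprimeRing hs (noInfiniteSum_iff.2 hg.no_infinite_direct_sum),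
      h.isLeftGoldie hs hg⟩
  · rintro ⟨hs, hg⟩
    have hg' : IsLeftGoldie Rᵐᵒᵖ := hg
    exact ⟨(h.op.isSemiprimeRing hs.op (noInfiniteSum_iff.2 hg'.no_infinite_direct_sum)).of_op,
      h.op.isLeftGoldie hs.op hg'⟩

end OreGoldie

/-! ### Subalgebras generated over `A` by one element -/

section Adjoin

variable {K B : Type*} [Field K] [Ring B] [Algebra K B]

/-- Elements obeying such a commutation rule are closed under sums and products, so generators
suffice. -/
theorem left_comm_adjoin {X : Set B} {y : B}
    (hX : ∀ x ∈ X, ∃ c ∈ Algebra.adjoin K X, ∃ d ∈ Algebra.adjoin K X, y * x = c * y + d)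
    {x : B} (hx : x ∈ Algebra.adjoin K X) :
    ∃ c ∈ Algebra.adjoin K X, ∃ d ∈ Algebra.adjoin K X, y * x = c * y + d := by
  induction hx using Algebra.adjoin_induction with
  | mem x hx => exact hX x hx
  | algebraMap k =>
    exact ⟨_, Subalgebra.algebraMap_mem _ k, 0, zero_mem _, by rw [add_zero, Algebra.commutes]⟩
  | add x z _ _ hx hz =>
    obtain ⟨c, hc, d, hd, h⟩ := hx
    obtain ⟨c', hc', d', hd', h'⟩ := hz
    exact ⟨c + c', add_mem hc hc', d + d', add_mem hd hd', by
      rw [mul_add, h, h', add_mul]; abel⟩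
  | mul x z _ hz₀ hx hz =>
    obtain ⟨c, hc, d, hd, h⟩ := hx
    obtain ⟨c', hc', d', hd', h'⟩ := hz
    refine ⟨c * c', mul_mem hc hc', c * d' + d * z, add_mem (mul_mem hc hd') (mul_mem hd hz₀), ?_⟩
    rw [← mul_assoc, h, add_mul, mul_assoc, h', mul_add, mul_assoc, add_assoc]

theorem right_comm_adjoin {X : Set B} {y : B}
    (hX : ∀ x ∈ X, ∃ c ∈ Algebra.adjoin K X, ∃ d ∈ Algebra.adjoin K X, x * y = y * c + d)
    {x : B} (hx : x ∈ Algebra.adjoin K X) :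
    ∃ c ∈ Algebra.adjoin K X, ∃ d ∈ Algebra.adjoin K X, x * y = y * c + d := by
  induction hx using Algebra.adjoin_induction with
  | mem x hx => exact hX x hx
  | algebraMap k =>
    exact ⟨_, Subalgebra.algebraMap_mem _ k, 0, zero_mem _, by rw [add_zero, Algebra.commutes]⟩
  | add x z _ _ hx hz =>
    obtain ⟨c, hc, d, hd, h⟩ := hx
    obtain ⟨c', hc', d', hd', h'⟩ := hz
    exact ⟨c + c', add_mem hc hc', d + d', add_mem hd hd', by
      rw [add_mul, h, h', mul_add]; abel⟩
  | mul x z hx₀ _ hx hz =>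
    obtain ⟨c, hc, d, hd, h⟩ := hx
    obtain ⟨c', hc', d', hd', h'⟩ := hz
    refine ⟨c * c', mul_mem hc hc', d * c' + x * d', add_mem (mul_mem hd hc') (mul_mem hx₀ hd'), ?_⟩
    rw [mul_assoc, h', mul_add, ← mul_assoc, h, add_mul, mul_assoc, add_assoc]

theorem le_adjoin_union (A : Subalgebra K B) (X : Set B) :
    A ≤ Algebra.adjoin K ((A : Set B) ∪ X) :=
  fun _ ha => Algebra.subset_adjoin (Or.inl ha)

theorem mem_adjoin_union (A : Subalgebra K B) (y : B) :
    y ∈ Algebra.adjoin K ((A : Set B) ∪ {y}) :=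
  Algebra.subset_adjoin (Or.inr rfl)

/-- The subalgebra generated by `A` and `y` is an Ore extension of `A`. -/
theorem exists_isOreExtension_adjoin (A : Subalgebra K B) (y : B)
    (hL : ∀ a : A, ∃ a' d : A, y * a = a' * y + d)
    (hR : ∀ a : A, ∃ a' d : A, a * y = y * a' + d)
    (uL : ∀ n (a : A), (a : B) * y ^ n ∈ degreeLT (A.val : A →+* B) y n → a = 0)
    (uR : ∀ a d : A, y * a = d → a = 0) :
    ∃ σ, IsOreExtension
      (Subalgebra.inclusion (le_adjoin_union A {y}) : A →+* Algebra.adjoin K ((A : Set B) ∪ {y})) σ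
      ⟨y, mem_adjoin_union A y⟩ := by
  set C := Algebra.adjoin K ((A : Set B) ∪ {y}) with hC
  obtain ⟨σ, hσ⟩ := exists_automorphism
    (ι := (Subalgebra.inclusion (le_adjoin_union A {y}) : A →+* C))
    (y := (⟨y, mem_adjoin_union A y⟩ : C))
    (fun a => by
      obtain ⟨a', d, h⟩ := hL a
      exact ⟨a', d, Subtype.ext h⟩)
    (fun a => by
      obtain ⟨a', d, h⟩ := hR a
      exact ⟨a', d, Subtype.ext h⟩)
    (fun a d h => by
      apply uL 1
      rw [pow_one, show (a : B) * y = d from congrArg Subtype.val h]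
      exact map_mem_degreeLT_one d)
    (fun a d h => uR a d (congrArg Subtype.val h))
  refine ⟨σ, hσ, fun n a h => uL n a ?_, ?_⟩
  · exact map_mem_degreeLT (C.val : C →+* B) h
  · refine exists_mem_degreeLT_of_adjoin hσ (K := K)
      (Algebra.adjoin_adjoin_coe_preimage (s := (A : Set B) ∪ {y})) ?_ ?_
    · rintro ⟨x, hx⟩ (hxA | hxy)
      · exact Or.inl ⟨⟨x, hxA⟩, rfl⟩
      · exact Or.inr (Subtype.ext hxy)
    · intro k
      exact ⟨algebraMap K A k, rfl⟩

end Adjoin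

/-! ### Coordinates in the left and right bases -/

section Coordinates

variable {K B : Type*} [Field K] [Ring B] [Algebra K B] {A : Subalgebra K B}

/-- The coordinates with respect to a basis of `B` as a left `A`-module. -/
theorem IsFreeBasis.exists_left_coord {v : ℕ × ℕ → B} (h : IsFreeBasis A v) :
    ∃ κ : ℕ × ℕ → B →+ A, (∀ p (a : A) x, κ p (a * x) = a * κ p x) ∧
      ∀ p q, κ p (v q) = if q = p then 1 else 0 := by
  let b := Module.Basis.mk h.1 h.2.ge
  refine ⟨fun p => (b.coord p).toAddMonoidHom, fun p a x => (b.coord p).map_smul a x, ?_⟩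
  intro p q
  have hb : v q = b q := (Module.Basis.mk_apply _ _ q).symm
  change b.coord p (v q) = _
  rw [hb, Module.Basis.coord_apply, Module.Basis.repr_self, Finsupp.single_apply]

/-- The coordinates with respect to a basis of `B` as a right `A`-module. -/
theorem IsFreeBasis.exists_right_coord {v : ℕ × ℕ → B}
    (h : IsFreeBasis A.op fun p => MulOpposite.op (v p)) :
    ∃ κ : ℕ × ℕ → B →+ A, (∀ p (a : A) x, κ p (x * a) = κ p x * a) ∧
      ∀ p q, κ p (v q) = if q = p then 1 else 0 := by
  let b := Module.Basis.mk h.1 h.2.ge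
  let κ : ℕ × ℕ → B →+ A := fun p =>
    { toFun := fun x => ⟨(b.coord p (MulOpposite.op x)).1.unop, (b.coord p (MulOpposite.op x)).2⟩
      map_zero' := by apply Subtype.ext; simp
      map_add' := fun x z => by apply Subtype.ext; simp }
  have hκ : ∀ p x, (κ p x : B) = (b.coord p (MulOpposite.op x)).1.unop := fun _ _ => rfl
  refine ⟨κ, fun p a x => ?_, fun p q => ?_⟩
  · have h1 := (b.coord p).map_smul ⟨MulOpposite.op (a : B), a.2⟩ (MulOpposite.op x)
    apply Subtype.ext
    exact congrArg (fun z => z.1.unop) h1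
  · apply Subtype.ext
    have hb : MulOpposite.op (v q) = b q := (congrFun (Module.Basis.coe_mk h.1 h.2.ge) q).symm
    rw [hκ, hb, Module.Basis.coord_apply, Module.Basis.repr_self, Finsupp.single_apply]
    split_ifs <;> rfl

end Coordinates

section LeftCoordinates

variable {K B : Type*} [Field K] [Ring B] [Algebra K B] {A : Subalgebra K B} {y₁ y₂ : B}

/-- `κ p` is the coefficient at `y₁ ^ p.1 * y₂ ^ p.2`, written on the left. -/
structure IsLeftCoord (y₁ y₂ : B) (κ : ℕ × ℕ → B →+ A) : Prop where
  mul : ∀ p (a : A) x, κ p (a * x) = a * κ p x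
  basis : ∀ p i j, κ p (y₁ ^ i * y₂ ^ j) = if (i, j) = p then 1 else 0

/-- `ρ p` is the coefficient at `y₂ ^ p.1 * y₁ ^ p.2`, written on the right. -/
structure IsRightCoord (y₁ y₂ : B) (ρ : ℕ × ℕ → B →+ A) : Prop where
  mul : ∀ p (a : A) x, ρ p (x * a) = ρ p x * a
  basis : ∀ p i j, ρ p (y₂ ^ i * y₁ ^ j) = if (i, j) = p then 1 else 0

namespace IsLeftCoord

variable {κ : ℕ × ℕ → B →+ A} (hκ : IsLeftCoord y₁ y₂ κ)
include hκ

theorem monomial (p : ℕ × ℕ) (a : A) (i j : ℕ) :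
    κ p (a * (y₁ ^ i * y₂ ^ j)) = if (i, j) = p then a else 0 := by
  rw [hκ.mul, hκ.basis, mul_ite, mul_one, mul_zero]

theorem smul (p : ℕ × ℕ) (k : K) (x : B) : κ p (k • x) = k • κ p x := by
  have := hκ.mul p (algebraMap K A k) x
  rw [← Algebra.smul_def] at this
  rw [← this]
  congr 1
  exact Algebra.smul_def k x

theorem fst (p : ℕ × ℕ) : κ p y₁ = if (1, 0) = p then 1 else 0 := by
  simpa using hκ.basis p 1 0

theorem snd (p : ℕ × ℕ) : κ p y₂ = if (0, 1) = p then 1 else 0 := by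
  simpa using hκ.basis p 0 1

theorem fst_mul_fst (p : ℕ × ℕ) : κ p (y₁ * y₁) = if (2, 0) = p then 1 else 0 := by
  simpa [pow_two] using hκ.basis p 2 0

theorem fst_mul_snd (p : ℕ × ℕ) : κ p (y₁ * y₂) = if (1, 1) = p then 1 else 0 := by
  simpa using hκ.basis p 1 1

theorem snd_mul_snd (p : ℕ × ℕ) : κ p (y₂ * y₂) = if (0, 2) = p then 1 else 0 := by
  simpa [pow_two] using hκ.basis p 0 2

theorem coe (p : ℕ × ℕ) (a : A) : κ p (a : B) = if (0, 0) = p then a else 0 := by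
  simpa using hκ.monomial p a 0 0

end IsLeftCoord

namespace IsRightCoord

variable {ρ : ℕ × ℕ → B →+ A} (hρ : IsRightCoord y₁ y₂ ρ)
include hρ

theorem monomial (p : ℕ × ℕ) (a : A) (i j : ℕ) :
    ρ p (y₂ ^ i * y₁ ^ j * a) = if (i, j) = p then a else 0 := by
  rw [hρ.mul, hρ.basis, ite_mul, one_mul, zero_mul]

theorem linear_eq_zero {b₁ b₂ b₀ : A} (h : y₁ * b₁ + y₂ * b₂ = (b₀ : B)) :
    b₁ = 0 ∧ b₂ = 0 := by
  have h1 : ∀ p, ρ p (y₁ * b₁) = if (0, 1) = p then b₁ else 0 := fun p => by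
    simpa using hρ.monomial p b₁ 0 1
  have h2 : ∀ p, ρ p (y₂ * b₂) = if (1, 0) = p then b₂ else 0 := fun p => by
    simpa using hρ.monomial p b₂ 1 0
  have h0 : ∀ p, ρ p (b₀ : B) = if (0, 0) = p then b₀ else 0 := fun p => by
    simpa using hρ.monomial p b₀ 0 0
  constructor
  · have := congrArg (ρ (0, 1)) h
    simpa [h1, h2, h0] using this
  · have := congrArg (ρ (1, 0)) h
    simpa [h1, h2, h0] using this

end IsRightCoord

variable {p₁₂ p₁₁ : K} {τ₀ τ₁ τ₂ : A} {σ : A → Matrix (Fin 2) (Fin 2) A} {δ : A → Fin 2 → A}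
  {κ ρ : ℕ × ℕ → B →+ A}

theorem IsDoubleExtension.exists_coord (hB : IsDoubleExtension A y₁ y₂ p₁₂ p₁₁ τ₀ τ₁ τ₂) :
    ∃ κ ρ : ℕ × ℕ → B →+ A, IsLeftCoord y₁ y₂ κ ∧ IsRightCoord y₁ y₂ ρ := by
  obtain ⟨κ, h1, h2⟩ := hB.left_basis.exists_left_coord
  obtain ⟨ρ, h3, h4⟩ := IsFreeBasis.exists_right_coord (v := fun n => y₂ ^ n.1 * y₁ ^ n.2)
    hB.right_basis
  exact ⟨κ, ρ, ⟨h1, fun p i j => h2 p (i, j)⟩, ⟨h3, fun p i j => h4 p (i, j)⟩⟩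

theorem IsDoubleExtension.exists_fst (hB : IsDoubleExtension A y₁ y₂ p₁₂ p₁₁ τ₀ τ₁ τ₂) (a : A) :
    ∃ b₁ b₂ b₀ : A, (a : B) * y₁ = y₁ * b₁ + y₂ * b₂ + b₀ := by
  have : (a : B) * y₁ ∈ leftLinear A y₁ y₂ := ⟨a, 0, 0, by simp⟩
  rwa [← hB.right_eq_left] at this

theorem IsDoubleExtension.exists_snd (hB : IsDoubleExtension A y₁ y₂ p₁₂ p₁₁ τ₀ τ₁ τ₂) (a : A) :
    ∃ b₁ b₂ b₀ : A, (a : B) * y₂ = y₁ * b₁ + y₂ * b₂ + b₀ := by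
  have : (a : B) * y₂ ∈ leftLinear A y₁ y₂ := ⟨0, a, 0, by simp⟩
  rwa [← hB.right_eq_left] at this

/-! ### The case σ₁₂ = 0: injectivity of σ₂₂ -/

section Lower

variable (hB : IsDoubleExtension A y₁ y₂ p₁₂ p₁₁ τ₀ τ₁ τ₂) (hσδ : IsStructureMaps A y₁ y₂ σ δ)
  (hκ : IsLeftCoord y₁ y₂ κ) (hρ : IsRightCoord y₁ y₂ ρ) (h12 : ∀ a, σ a 0 1 = 0)
include hσδ h12

theorem fst_mul_of_lower (a : A) : y₁ * (a : B) = σ a 0 0 * y₁ + δ a 0 := by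
  have := (hσδ a).1
  rwa [h12, ZeroMemClass.coe_zero, zero_mul, add_zero] at this

include hB hκ hρ

/-- Put u = σ₁₁(b), s = σ₂₁(b) and compare y₂(y₁b) with (y₂y₁)b. The y₁y₂-coefficient gives σ₂₂(u) =
0, the y₁²-coefficient gives σ₂₁(u) = p₁₂σ₁₁(s) + p₁₁σ₁₁(u). Hence y₂u − y₁(p₁₂s + p₁₁u) lies in
`A`, and the right basis gives u = 0. Then y₁b lies in `A`, so b = 0. -/
theorem eq_zero_of_sigma_snd_snd_eq_zero (b : A) (hb : σ b 1 1 = 0) : b = 0 := by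
  have hy₁ := fst_mul_of_lower hσδ h12
  have hy₂ := fun a => (hσδ a).2
  have e1 : y₂ * (b : B) = σ b 1 0 * y₁ + δ b 1 := by
    have := hy₂ b
    rwa [hb, ZeroMemClass.coe_zero, zero_mul, add_zero] at this
  set s := σ b 1 0
  set u := σ b 0 0
  have key : y₂ * (y₁ * (b : B)) = y₂ * y₁ * b := (mul_assoc _ _ _).symm
  have hl : y₂ * (y₁ * (b : B)) = σ u 1 0 * (y₁ * y₁) + σ u 1 1 * (y₂ * y₁) + δ u 1 * y₁
      + (σ (δ b 0) 1 0 * y₁ + σ (δ b 0) 1 1 * y₂ + δ (δ b 0) 1) := by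
    rw [hy₁ b, mul_add, hy₂ (δ b 0), ← mul_assoc y₂, hy₂ u]
    simp only [add_mul, mul_assoc]
  have hr : y₂ * y₁ * (b : B) = p₁₂ • (σ s 0 0 * (y₁ * y₁) + δ s 0 * y₁
        + (σ (δ b 1) 0 0 * y₁ + δ (δ b 1) 0))
      + p₁₁ • (σ u 0 0 * (y₁ * y₁) + δ u 0 * y₁ + (σ (δ b 0) 0 0 * y₁ + δ (δ b 0) 0))
      + τ₁ * (u * y₁ + δ b 0) + τ₂ * (s * y₁ + δ b 1) + τ₀ * b := by
    rw [hB.relation, pow_two]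
    simp only [add_mul, smul_mul_assoc, mul_assoc, e1, hy₁ b]
    congr 4
    · congr 1
      rw [mul_add, hy₁ (δ b 1), ← mul_assoc, hy₁ s, add_mul, mul_assoc]
    · congr 1
      rw [mul_add, hy₁ (δ b 0), ← mul_assoc, hy₁ u, add_mul, mul_assoc]
  rw [hl, hr, hB.relation, pow_two] at key
  have h11 := congrArg (κ (1, 1)) key
  have h20 := congrArg (κ (2, 0)) key
  simp [hκ.mul, hκ.smul, hκ.fst, hκ.snd, hκ.fst_mul_fst, hκ.fst_mul_snd, hκ.coe,
    hB.p₁₂_ne_zero] at h11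
  simp [hκ.mul, hκ.smul, hκ.fst, hκ.snd, hκ.fst_mul_fst, hκ.coe, h11] at h20
  have hu := hy₂ u
  rw [h11, h20] at hu
  have hlin : y₁ * ((-(p₁₂ • s + p₁₁ • u) : A) : B) + y₂ * (u : B)
      = ((δ u 1 - p₁₂ • δ s 0 - p₁₁ • δ u 0 : A) : B) := by
    rw [hu]
    push_cast
    rw [mul_neg, mul_add, mul_smul_comm, mul_smul_comm, hy₁ s, hy₁ u]
    simp only [add_mul, smul_mul_assoc, smul_add, zero_mul]
    abel
  have hu0 := (hρ.linear_eq_zero hlin).2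
  have hb0 := hy₁ b
  rw [show σ b 0 0 = 0 from hu0, ZeroMemClass.coe_zero, zero_mul, zero_add] at hb0
  exact (hρ.linear_eq_zero (b₁ := b) (b₂ := 0) (b₀ := δ b 0) (by simpa using hb0)).1

/-- The left y₂-coefficient of y₁b₁ + y₂b₂ + b₀ is σ₂₂(b₂), while that of a y₁ is zero; injectivity
of σ₂₂ removes b₂. -/
theorem exists_mul_fst_of_lower (a : A) : ∃ a' d : A, (a : B) * y₁ = y₁ * a' + d := by
  obtain ⟨b₁, b₂, b₀, h⟩ := hB.exists_fst a
  have h01 := congrArg (κ (0, 1)) h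
  rw [(hσδ b₂).2, fst_mul_of_lower hσδ h12] at h01
  simp [hκ.mul, hκ.fst, hκ.snd, hκ.coe] at h01
  have hb₂ := eq_zero_of_sigma_snd_snd_eq_zero hB hσδ hκ hρ h12 b₂ (by simpa using h01.symm)
  exact ⟨b₁, b₀, by simpa [hb₂] using h⟩

end Lower

/-! ### The case σ₂₁ = 0 and p₁₁ = 0: injectivity of σ₁₁ -/

section Upper

variable (hB : IsDoubleExtension A y₁ y₂ p₁₂ 0 τ₀ τ₁ τ₂) (hσδ : IsStructureMaps A y₁ y₂ σ δ)
  (hκ : IsLeftCoord y₁ y₂ κ) (hρ : IsRightCoord y₁ y₂ ρ) (h21 : ∀ a, σ a 1 0 = 0)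
include hσδ h21

theorem snd_mul_of_upper (a : A) : y₂ * (a : B) = σ a 1 1 * y₂ + δ a 1 := by
  have := (hσδ a).2
  rwa [h21, ZeroMemClass.coe_zero, zero_mul, zero_add] at this

include hB hκ hρ

/-- Now s = σ₁₂(b) and u = σ₂₂(b). The two values of y₂y₁b give σ₁₁(u) = 0 and σ₂₂(s) = p₁₂σ₁₂(u),
so y₁(p₁₂u) − y₂s lies in `A`. The right basis gives u = 0, then b = 0. -/
theorem eq_zero_of_sigma_fst_fst_eq_zero (b : A) (hb : σ b 0 0 = 0) : b = 0 := by
  have hy₂ := snd_mul_of_upper hσδ h21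
  have hy₁ := fun a => (hσδ a).1
  have e1 : y₁ * (b : B) = σ b 0 1 * y₂ + δ b 0 := by
    have := hy₁ b
    rwa [hb, ZeroMemClass.coe_zero, zero_mul, zero_add] at this
  set s := σ b 0 1
  set u := σ b 1 1
  have key : y₂ * (y₁ * (b : B)) = y₂ * y₁ * b := (mul_assoc _ _ _).symm
  have hl : y₂ * (y₁ * (b : B)) = σ s 1 1 * (y₂ * y₂) + δ s 1 * y₂
      + (σ (δ b 0) 1 1 * y₂ + δ (δ b 0) 1) := by
    rw [e1, mul_add, hy₂ (δ b 0), ← mul_assoc y₂, hy₂ s]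
    simp only [add_mul, mul_assoc]
  have hr : y₂ * y₁ * (b : B) = p₁₂ • (σ u 0 0 * (y₁ * y₂) + σ u 0 1 * (y₂ * y₂) + δ u 0 * y₂
        + (σ (δ b 1) 0 0 * y₁ + σ (δ b 1) 0 1 * y₂ + δ (δ b 1) 0))
      + τ₁ * (s * y₂ + δ b 0) + τ₂ * (u * y₂ + δ b 1) + τ₀ * b := by
    rw [hB.relation, zero_smul, add_zero]
    simp only [add_mul, smul_mul_assoc, mul_assoc, e1, hy₂ b]
    congr 4
    rw [mul_add, hy₁ (δ b 1), ← mul_assoc, hy₁ u]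
    simp only [add_mul, mul_assoc]
  rw [hl, hr] at key
  have h11 := congrArg (κ (1, 1)) key
  have h02 := congrArg (κ (0, 2)) key
  simp [hκ.mul, hκ.smul, hκ.fst, hκ.snd, hκ.snd_mul_snd, hκ.fst_mul_snd, hκ.coe] at h11
  have hu00 : σ u 0 0 = 0 := (smul_eq_zero.1 h11.symm).resolve_left hB.p₁₂_ne_zero
  simp [hκ.mul, hκ.smul, hκ.fst, hκ.snd, hκ.snd_mul_snd, hκ.fst_mul_snd, hκ.coe] at h02
  have hu := hy₁ u
  have hs := hy₂ s
  rw [h02] at hs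
  have hlin : y₁ * ((p₁₂ • u : A) : B) + y₂ * ((-s : A) : B)
      = ((p₁₂ • δ u 0 - δ s 1 : A) : B) := by
    push_cast
    rw [mul_neg, mul_smul_comm, hu, hs, hu00]
    simp only [smul_add, ZeroMemClass.coe_zero, zero_mul, zero_add, A.coe_smul, smul_mul_assoc]
    abel
  have hu0 : u = 0 := by
    have := (hρ.linear_eq_zero hlin).1
    exact (smul_eq_zero.1 this).resolve_left hB.p₁₂_ne_zero
  have hb0 := hy₂ b
  rw [show σ b 1 1 = 0 from hu0, ZeroMemClass.coe_zero, zero_mul, zero_add] at hb0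
  exact (hρ.linear_eq_zero (b₁ := 0) (b₂ := b) (b₀ := δ b 1) (by simpa using hb0)).2

theorem exists_mul_snd_of_upper (a : A) : ∃ a' d : A, (a : B) * y₂ = y₂ * a' + d := by
  obtain ⟨b₁, b₂, b₀, h⟩ := hB.exists_snd a
  have h10 := congrArg (κ (1, 0)) h
  rw [(hσδ b₁).1, snd_mul_of_upper hσδ h21] at h10
  simp [hκ.mul, hκ.fst, hκ.snd, hκ.coe] at h10
  have hb₁ := eq_zero_of_sigma_fst_fst_eq_zero hB hσδ hκ hρ h21 b₁ (by simpa using h10.symm)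
  exact ⟨b₂, b₀, by simpa [hb₁] using h⟩

end Upper

end LeftCoordinates

/-! ### The two iterated Ore extensions -/

section Forms

variable {K B : Type*} [Field K] [Ring B] [Algebra K B] {A : Subalgebra K B} {y₁ y₂ : B}
  {κ ρ : ℕ × ℕ → B →+ A}

theorem IsOreExtension.exists_left_sum {y : B}
    {σ : A ≃+* A} (h : IsOreExtension
      (Subalgebra.inclusion (le_adjoin_union A {y}) : A →+* Algebra.adjoin K ((A : Set B) ∪ {y})) σ
      ⟨y, mem_adjoin_union A y⟩) {c : B} (hc : c ∈ Algebra.adjoin K ((A : Set B) ∪ {y})) :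
    ∃ (N : ℕ) (f : ℕ → A), c = ∑ i ∈ Finset.range N, (f i : B) * y ^ i := by
  obtain ⟨N, hN⟩ := h.exhaust ⟨c, hc⟩
  obtain ⟨f, hf⟩ := exists_left_sum_of_mem_degreeLT hN
  refine ⟨N, f, (congrArg Subtype.val hf).trans ?_⟩
  simp

theorem IsOreExtension.exists_right_sum {y : B}
    {σ : A ≃+* A} (h : IsOreExtension
      (Subalgebra.inclusion (le_adjoin_union A {y}) : A →+* Algebra.adjoin K ((A : Set B) ∪ {y})) σ
      ⟨y, mem_adjoin_union A y⟩) {c : B} (hc : c ∈ Algebra.adjoin K ((A : Set B) ∪ {y})) :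
    ∃ (N : ℕ) (f : ℕ → A), c = ∑ i ∈ Finset.range N, y ^ i * (f i : B) := by
  obtain ⟨N, hN⟩ := h.exhaust ⟨c, hc⟩
  obtain ⟨f, hf⟩ := exists_right_sum_of_mem_degreeLT h.comm hN
  refine ⟨N, f, (congrArg Subtype.val hf).trans ?_⟩
  simp

theorem IsLeftCoord.fst_pow (hκ : IsLeftCoord y₁ y₂ κ) (p : ℕ × ℕ) (a : A) (i : ℕ) :
    κ p (a * y₁ ^ i) = if (i, 0) = p then a else 0 := by
  simpa using hκ.monomial p a i 0

theorem IsLeftCoord.snd_pow (hκ : IsLeftCoord y₁ y₂ κ) (p : ℕ × ℕ) (a : A) (i : ℕ) :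
    κ p (a * y₂ ^ i) = if (0, i) = p then a else 0 := by
  simpa using hκ.monomial p a 0 i

theorem IsRightCoord.fst_pow (hρ : IsRightCoord y₁ y₂ ρ) (p : ℕ × ℕ) (a : A) (i : ℕ) :
    ρ p (y₁ ^ i * a) = if (0, i) = p then a else 0 := by
  simpa using hρ.monomial p a 0 i

theorem IsRightCoord.snd_pow (hρ : IsRightCoord y₁ y₂ ρ) (p : ℕ × ℕ) (a : A) (i : ℕ) :
    ρ p (y₂ ^ i * a) = if (i, 0) = p then a else 0 := by
  simpa using hρ.monomial p a i 0

variable {p₁₂ p₁₁ : K} {τ₀ τ₁ τ₂ : A} {σ : A → Matrix (Fin 2) (Fin 2) A} {δ : A → Fin 2 → A}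

/-- With `C = A[y₁]`, both given bases have the order needed for `B = C[y₂]`: y₁ⁱy₂ʲ puts `C` on the
left of y₂ʲ, and y₂ⁱy₁ʲ puts it on the right of y₂ⁱ. -/
theorem IsDoubleExtension.transfersTo_of_lower
    (hB : IsDoubleExtension A y₁ y₂ p₁₂ p₁₁ τ₀ τ₁ τ₂) (hσδ : IsStructureMaps A y₁ y₂ σ δ)
    (h12 : ∀ a, σ a 0 1 = 0) : TransfersTo A B := by
  obtain ⟨κ, ρ, hκ, hρ⟩ := hB.exists_coord
  obtain ⟨σ₁, h₁⟩ := exists_isOreExtension_adjoin A y₁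
    (fun a => ⟨_, _, fst_mul_of_lower hσδ h12 a⟩)
    (exists_mul_fst_of_lower hB hσδ hκ hρ h12)
    (fun n a h => by
      obtain ⟨f, hf⟩ := exists_left_sum_of_mem_degreeLT h
      have := congrArg (κ (n, 0)) hf
      rw [hκ.fst_pow, if_pos rfl, map_sum, Finset.sum_eq_zero] at this
      · exact this
      · intro i hi
        have hne : (i, 0) ≠ (n, 0) := by simpa using (Finset.mem_range.1 hi).ne
        exact (hκ.fst_pow _ _ _).trans (if_neg hne))
    (fun a d h => (hρ.linear_eq_zero (b₁ := a) (b₂ := 0) (b₀ := d) (by simpa using h)).1)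
  refine h₁.transfersTo.trans ?_
  have hleft := fun c hc => h₁.exists_left_sum (c := c) hc
  have hright := fun c hc => h₁.exists_right_sum (c := c) hc
  set C := Algebra.adjoin K ((A : Set B) ∪ {y₁}) with hC
  have hA : ∀ a : A, (a : B) ∈ C := fun a => le_adjoin_union A {y₁} a.2
  have hy : y₁ ∈ C := mem_adjoin_union A y₁
  have hL : ∀ c : C, ∃ c' d : C, y₂ * (c : B) = c' * y₂ + d := by
    rintro ⟨c, hc⟩
    obtain ⟨c', hc', d, hd, h⟩ := left_comm_adjoin (y := y₂) (by
      rintro x (hx | rfl)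
      · refine ⟨_, hA (σ ⟨x, hx⟩ 1 1), _,
          add_mem (mul_mem (hA (σ ⟨x, hx⟩ 1 0)) hy) (hA (δ ⟨x, hx⟩ 1)), ?_⟩
        rw [(hσδ ⟨x, hx⟩).2]
        abel
      · refine ⟨p₁₂ • x + τ₂, add_mem (C.smul_mem hy _) (hA _), p₁₁ • x ^ 2 + τ₁ * x + τ₀,
          add_mem (add_mem (C.smul_mem (pow_mem hy 2) _) (mul_mem (hA _) hy)) (hA _), ?_⟩
        rw [hB.relation, add_mul, smul_mul_assoc]
        abel) hc
    exact ⟨⟨c', hc'⟩, ⟨d, hd⟩, h⟩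
  have hR : ∀ c : C, ∃ c' d : C, (c : B) * y₂ = y₂ * c' + d := by
    rintro ⟨c, hc⟩
    obtain ⟨c', hc', d, hd, h⟩ := right_comm_adjoin (y := y₂) (by
      rintro x (hx | rfl)
      · obtain ⟨b₁, b₂, b₀, hb⟩ := hB.exists_snd ⟨x, hx⟩
        refine ⟨b₂, hA _, y₁ * b₁ + b₀, add_mem (mul_mem hy (hA _)) (hA _), ?_⟩
        rw [show x * y₂ = _ from hb]
        abel
      · obtain ⟨t₁, t₂, t₀, ht⟩ := hB.exists_snd τ₂
        -- The relation is solved for y₁y₂, after τ₂y₂ is rewritten as y₁t₁ + y₂t₂ + t₀.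
        refine ⟨p₁₂⁻¹ • (x - t₂), C.smul_mem (sub_mem hy (hA _)) _,
          -(p₁₂⁻¹ • (p₁₁ • x ^ 2 + τ₁ * x + (x * t₁ + t₀) + τ₀)),
          neg_mem (C.smul_mem (add_mem (add_mem (add_mem (C.smul_mem (pow_mem hy 2) _)
            (mul_mem (hA _) hy)) (add_mem (mul_mem hy (hA _)) (hA _))) (hA _)) _), ?_⟩
        have hrel : p₁₂ • (x * y₂)
            = y₂ * (x - t₂) - (p₁₁ • x ^ 2 + τ₁ * x + (x * t₁ + t₀) + τ₀) := by
          rw [mul_sub, hB.relation, ht]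
          abel
        rw [← inv_smul_smul₀ hB.p₁₂_ne_zero (x * y₂), hrel, smul_sub, mul_smul_comm,
          sub_eq_add_neg]) hc
    exact ⟨⟨c', hc'⟩, ⟨d, hd⟩, h⟩
  have hcoord : ∀ (N : ℕ) (f : ℕ → A) (j k n : ℕ),
      κ (k, n) ((∑ i ∈ Finset.range N, (f i : B) * y₁ ^ i) * y₂ ^ j)
        = if j = n ∧ k < N then f k else 0 := by
    intro N f j k n
    rw [Finset.sum_mul, map_sum]
    simp only [mul_assoc, hκ.monomial, Prod.mk.injEq]
    split_ifs with hjk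
    · rw [Finset.sum_eq_single_of_mem k (Finset.mem_range.2 hjk.2)]
      · rw [if_pos ⟨rfl, hjk.1⟩]
      · intro i _ hi
        rw [if_neg fun h => hi h.1]
    · refine Finset.sum_eq_zero fun i hi => if_neg fun h => hjk ⟨h.2, ?_⟩
      rw [← h.1]
      exact Finset.mem_range.1 hi
  have uL : ∀ n (c : C), (c : B) * y₂ ^ n ∈ degreeLT (C.val : C →+* B) y₂ n → c = 0 := by
    rintro n ⟨c, hc⟩ hmem
    obtain ⟨g, hg⟩ := exists_left_sum_of_mem_degreeLT hmem
    obtain ⟨N, f, rfl⟩ := hleft c hc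
    have hf : ∀ k ∈ Finset.range N, f k = 0 := by
      intro k hk
      have := congrArg (κ (k, n)) hg
      rw [hcoord, if_pos ⟨rfl, Finset.mem_range.1 hk⟩, map_sum, Finset.sum_eq_zero] at this
      · exact this
      · intro j hj
        obtain ⟨N', f', hf'⟩ := hleft (g j) (g j).2
        change κ (k, n) ((g j : B) * y₂ ^ j) = 0
        rw [hf', hcoord, if_neg]
        exact fun h => (Finset.mem_range.1 hj).ne h.1
    rw [← ZeroMemClass.coe_eq_zero]
    dsimp only
    refine Finset.sum_eq_zero fun k hk => ?_
    rw [hf k hk]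
    simp
  have uR : ∀ c d : C, y₂ * (c : B) = d → c = 0 := by
    rintro ⟨c, hc⟩ ⟨d, hd⟩ h
    obtain ⟨N, f, rfl⟩ := hright c hc
    obtain ⟨M, g, rfl⟩ := hright d hd
    have hf : ∀ k ∈ Finset.range N, f k = 0 := by
      intro k hk
      have := congrArg (ρ (1, k)) h
      have e : ∀ i, ρ (1, k) (y₂ * (y₁ ^ i * (f i : B))) = if i = k then f i else 0 := fun i => by
        simpa [mul_assoc] using hρ.monomial (1, k) (f i) 1 i
      simpa [Finset.mul_sum, e, hρ.fst_pow, Finset.mem_range.1 hk] using this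
    rw [← ZeroMemClass.coe_eq_zero]
    dsimp only
    refine Finset.sum_eq_zero fun k hk => ?_
    rw [hf k hk]
    simp
  obtain ⟨σ₂, hσ₂⟩ := exists_automorphism (ι := (C.val : C →+* B)) (y := y₂) hL hR
    (fun c d h => uL 1 c (by
      rw [pow_one, show (c : B) * y₂ = d from h]
      exact map_mem_degreeLT_one d)) uR
  refine IsOreExtension.transfersTo ⟨hσ₂, uL, ?_⟩
  refine exists_mem_degreeLT_of_adjoin hσ₂ hB.generated ?_
    (fun k => ⟨algebraMap K C k, rfl⟩)
  rintro x (hx | rfl | rfl)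
  · exact Or.inl ⟨⟨x, hA ⟨x, hx⟩⟩, rfl⟩
  · exact Or.inl ⟨⟨x, hy⟩, rfl⟩
  · exact Or.inr rfl

/-- With `C = A[y₂]` over which y₁ is adjoined, the left basis y₁ⁱy₂ʲ has `C` on the wrong side:
left coefficients in `A` must first cross y₁ⁱ. Freeness is therefore proved for the form y₁ⁿc and
carried to the left by `eq_zero_of_map_mul_pow_mem`. -/
theorem IsDoubleExtension.transfersTo_of_upper
    (hB : IsDoubleExtension A y₁ y₂ p₁₂ 0 τ₀ τ₁ τ₂) (hσδ : IsStructureMaps A y₁ y₂ σ δ)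
    (h21 : ∀ a, σ a 1 0 = 0) : TransfersTo A B := by
  obtain ⟨κ, ρ, hκ, hρ⟩ := hB.exists_coord
  have hinj := eq_zero_of_sigma_fst_fst_eq_zero hB hσδ hκ hρ h21
  obtain ⟨σ₁, h₁⟩ := exists_isOreExtension_adjoin A y₂
    (fun a => ⟨_, _, snd_mul_of_upper hσδ h21 a⟩)
    (exists_mul_snd_of_upper hB hσδ hκ hρ h21)
    (fun n a h => by
      obtain ⟨f, hf⟩ := exists_left_sum_of_mem_degreeLT h
      have := congrArg (κ (0, n)) hf
      rw [hκ.snd_pow, if_pos rfl, map_sum, Finset.sum_eq_zero] at this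
      · exact this
      · intro i hi
        have hne : (0, i) ≠ (0, n) := by simpa using (Finset.mem_range.1 hi).ne
        exact (hκ.snd_pow _ _ _).trans (if_neg hne))
    (fun a d h => (hρ.linear_eq_zero (b₁ := 0) (b₂ := a) (b₀ := d) (by simpa using h)).2)
  refine h₁.transfersTo.trans ?_
  have hleft := fun c hc => h₁.exists_left_sum (c := c) hc
  have hright := fun c hc => h₁.exists_right_sum (c := c) hc
  set C := Algebra.adjoin K ((A : Set B) ∪ {y₂}) with hC
  have hA : ∀ a : A, (a : B) ∈ C := fun a => le_adjoin_union A {y₂} a.2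
  have hy : y₂ ∈ C := mem_adjoin_union A y₂
  have hL : ∀ c : C, ∃ c' d : C, y₁ * (c : B) = c' * y₁ + d := by
    rintro ⟨c, hc⟩
    obtain ⟨c', hc', d, hd, h⟩ := left_comm_adjoin (y := y₁) (by
      rintro x (hx | rfl)
      · refine ⟨_, hA (σ ⟨x, hx⟩ 0 0), _,
          add_mem (mul_mem (hA (σ ⟨x, hx⟩ 0 1)) hy) (hA (δ ⟨x, hx⟩ 0)), ?_⟩
        rw [(hσδ ⟨x, hx⟩).1]
        abel
      · refine ⟨p₁₂⁻¹ • (x - τ₁), C.smul_mem (sub_mem hy (hA _)) _,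
          -(p₁₂⁻¹ • (τ₂ * x + τ₀)),
          neg_mem (C.smul_mem (add_mem (mul_mem (hA _) hy) (hA _)) _), ?_⟩
        have hrel : p₁₂ • (y₁ * x) = (x - τ₁) * y₁ - (τ₂ * x + τ₀) := by
          rw [sub_mul, hB.relation, zero_smul]
          abel
        rw [← inv_smul_smul₀ hB.p₁₂_ne_zero (y₁ * x), hrel, smul_sub, smul_mul_assoc,
          sub_eq_add_neg]) hc
    exact ⟨⟨c', hc'⟩, ⟨d, hd⟩, h⟩
  have hR : ∀ c : C, ∃ c' d : C, (c : B) * y₁ = y₁ * c' + d := by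
    rintro ⟨c, hc⟩
    obtain ⟨c', hc', d, hd, h⟩ := right_comm_adjoin (y := y₁) (by
      rintro x (hx | rfl)
      · obtain ⟨b₁, b₂, b₀, hb⟩ := hB.exists_fst ⟨x, hx⟩
        refine ⟨b₁, hA _, y₂ * b₂ + b₀, add_mem (mul_mem hy (hA _)) (hA _), ?_⟩
        rw [show x * y₁ = _ from hb]
        abel
      · obtain ⟨t₁, t₂, t₀, ht⟩ := hB.exists_fst τ₁
        refine ⟨p₁₂ • x + t₁, add_mem (C.smul_mem hy _) (hA _),
          x * t₂ + t₀ + τ₂ * x + τ₀, add_mem (add_mem (add_mem (mul_mem hy (hA _)) (hA _))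
            (mul_mem (hA _) hy)) (hA _), ?_⟩
        rw [hB.relation, zero_smul, ht, mul_add, mul_smul_comm]
        abel) hc
    exact ⟨⟨c', hc'⟩, ⟨d, hd⟩, h⟩
  -- Both bases enter. Right coordinates at y₂ᵏy₁ kill the y₁-part of f_k y₁ = y₁b₁ + y₂b₂ + b₀;
  -- since σ₂₁ = 0 the rest has no left y₁-coefficient, yet that coefficient is f_k.
  have uL1 : ∀ c d : C, (c : B) * y₁ = d → c = 0 := by
    rintro ⟨c, hc⟩ ⟨d, hd⟩ h
    obtain ⟨N, f, rfl⟩ := hright c hc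
    obtain ⟨M, g, rfl⟩ := hright d hd
    choose b₁ b₂ b₀ hb using fun i => hB.exists_fst (f i)
    have hf : ∀ k ∈ Finset.range N, f k = 0 := by
      intro k hk
      have h1 := congrArg (ρ (k, 1)) h
      have e : ∀ i, ρ (k, 1) (y₂ ^ i * (f i : B) * y₁) = if i = k then b₁ i else 0 := fun i => by
        rw [show y₂ ^ i * (f i : B) * y₁
          = y₂ ^ i * y₁ ^ 1 * b₁ i + y₂ ^ (i + 1) * b₂ i + y₂ ^ i * b₀ i by
            rw [mul_assoc, hb, pow_one, mul_add, mul_add, pow_succ]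
            simp only [mul_assoc], map_add, map_add, hρ.monomial, hρ.snd_pow, hρ.snd_pow]
        simp
      have h2 : b₁ k = 0 := by
        simpa [Finset.sum_mul, e, hρ.snd_pow, Finset.mem_range.1 hk] using h1
      have h3 := hb k
      rw [h2, snd_mul_of_upper hσδ h21] at h3
      have h4 := congrArg (κ (1, 0)) h3
      simpa [hκ.mul, hκ.fst, hκ.snd, hκ.coe] using h4
    rw [← ZeroMemClass.coe_eq_zero]
    dsimp only
    refine Finset.sum_eq_zero fun k hk => ?_
    rw [hf k hk]
    simp
  have uR : ∀ c d : C, y₁ * (c : B) = d → c = 0 := by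
    rintro ⟨c, hc⟩ ⟨d, hd⟩ h
    obtain ⟨N, f, rfl⟩ := hleft c hc
    obtain ⟨M, g, rfl⟩ := hleft d hd
    have hf : ∀ k ∈ Finset.range N, f k = 0 := by
      intro k hk
      apply hinj
      have h1 := congrArg (κ (1, k)) h
      have e : ∀ i, κ (1, k) (y₁ * ((f i : B) * y₂ ^ i)) = if i = k then σ (f i) 0 0 else 0 :=
        fun i => by
        rw [show y₁ * ((f i : B) * y₂ ^ i) = σ (f i) 0 0 * (y₁ ^ 1 * y₂ ^ i)
          + σ (f i) 0 1 * y₂ ^ (i + 1) + δ (f i) 0 * y₂ ^ i by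
            rw [← mul_assoc, (hσδ (f i)).1, pow_one, add_mul, add_mul, pow_succ']
            simp only [mul_assoc], map_add, map_add, hκ.monomial, hκ.snd_pow, hκ.snd_pow]
        simp
      simpa [Finset.mul_sum, e, hκ.snd_pow, Finset.mem_range.1 hk] using h1
    rw [← ZeroMemClass.coe_eq_zero]
    dsimp only
    refine Finset.sum_eq_zero fun k hk => ?_
    rw [hf k hk]
    simp
  obtain ⟨σ₂, hσ₂⟩ := exists_automorphism (ι := (C.val : C →+* B)) (y := y₁) hL hR uL1 uR
  -- The automorphism of `C` extends σ₁₁, so its powers keep `A` inside `A` and coefficients in `A`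
  -- can cross y₁ⁿ without leaving `A` at top degree.
  have hσ₂A : ∀ a : A, σ₂ ⟨a, hA a⟩ = ⟨σ a 0 0, hA _⟩ := by
    intro a
    obtain ⟨d, hd⟩ := hσ₂ ⟨a, hA a⟩
    rw [← sub_eq_zero]
    refine uL1 _ (⟨σ a 0 1 * y₂ + δ a 0, add_mem (mul_mem (hA _) hy) (hA _)⟩ - d) ?_
    have hd' : y₁ * (a : B) = (σ₂ ⟨a, hA a⟩ : B) * y₁ + d := hd
    rw [(hσδ a).1] at hd'
    push_cast
    rw [sub_mul, sub_eq_sub_iff_add_eq_add, ← hd']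
    abel
  have hpow : ∀ n (a : A), ∃ a' : A, (σ₂ ^ n) ⟨a, hA a⟩ = ⟨a', hA a'⟩ := by
    intro n a
    induction n with
    | zero => exact ⟨a, rfl⟩
    | succ n ih =>
      obtain ⟨a', ha'⟩ := ih
      refine ⟨σ a' 0 0, ?_⟩
      rw [pow_succ', RingAut.mul_apply, ha', hσ₂A]
  choose θ hθ using hpow
  have hterm : ∀ n (a : A) (i : ℕ), ∃ t ∈ degreeLT (C.val : C →+* B) y₁ n,
      y₁ ^ n * ((a : B) * y₂ ^ i) = θ n a * (y₁ ^ n * y₂ ^ i) + t := by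
    intro n a i
    have h1 := pow_mul_map_sub_mem hσ₂ n ⟨a, hA a⟩
    rw [hθ] at h1
    refine ⟨_, mul_map_mem hσ₂ ⟨y₂ ^ i, pow_mem hy i⟩ h1, ?_⟩
    change _ = (θ n a : B) * (y₁ ^ n * y₂ ^ i) + (y₁ ^ n * (a : B) - (θ n a : B) * y₁ ^ n) * y₂ ^ i
    noncomm_ring
  -- The y₁-degree over `C` bounds the y₁-exponent in the left basis over `A`, so the lower-degree
  -- errors are invisible at y₁ⁿy₂ⁱ.
  have hvanish : ∀ n, ∀ x ∈ degreeLT (C.val : C →+* B) y₁ n, ∀ k i, n ≤ k → κ (k, i) x = 0 := by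
    intro n
    induction n with
    | zero =>
      intro x hx k i _
      rw [mem_degreeLT_zero.1 hx, map_zero]
    | succ n ih =>
      intro x hx k i hk
      obtain ⟨⟨c, hc⟩, hr⟩ := (mem_degreeLT_succ_right hσ₂).1 hx
      obtain ⟨N, f, rfl⟩ := hleft c hc
      have h1 := ih _ hr k i (by omega)
      rw [map_sub, sub_eq_zero] at h1
      rw [h1]
      change κ (k, i) (y₁ ^ n * ∑ i ∈ Finset.range N, (f i : B) * y₂ ^ i) = 0
      rw [Finset.mul_sum, map_sum]
      refine Finset.sum_eq_zero fun j _ => ?_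
      obtain ⟨t, ht, e⟩ := hterm n (f j) j
      rw [e, map_add, ih t ht k i (by omega), hκ.monomial, if_neg, add_zero]
      intro h2
      have := congrArg Prod.fst h2
      dsimp at this
      omega
  have huniq : ∀ n (c : C), y₁ ^ n * (c : B) ∈ degreeLT (C.val : C →+* B) y₁ n → c = 0 := by
    rintro n ⟨c, hc⟩ hmem
    obtain ⟨N, f, rfl⟩ := hleft c hc
    have hf : ∀ k ∈ Finset.range N, f k = 0 := by
      intro k hk
      have h1 := hvanish n _ hmem n k le_rfl
      rw [Finset.mul_sum, map_sum, Finset.sum_eq_single_of_mem k hk] at h1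
      · obtain ⟨t, ht, e⟩ := hterm n (f k) k
        rw [e, map_add, hvanish n t ht n k le_rfl, hκ.monomial, if_pos rfl, add_zero] at h1
        have h2 := hθ n (f k)
        have h3 : (σ₂ ^ n) ⟨f k, hA (f k)⟩ = 0 := by
          rw [h2]
          apply Subtype.ext
          simp [h1]
        have h4 := (map_eq_zero_iff _ (σ₂ ^ n).injective).1 h3
        have h5 : (f k : B) = 0 := congrArg Subtype.val h4
        exact Subtype.ext h5
      · intro j _ hj
        obtain ⟨t, ht, e⟩ := hterm n (f j) j
        rw [e, map_add, hvanish n t ht n k le_rfl, hκ.monomial, if_neg, add_zero]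
        exact fun h2 => hj (congrArg Prod.snd h2)
    rw [← ZeroMemClass.coe_eq_zero]
    dsimp only
    refine Finset.sum_eq_zero fun k hk => ?_
    rw [hf k hk]
    simp
  refine IsOreExtension.transfersTo ⟨hσ₂, eq_zero_of_map_mul_pow_mem hσ₂ huniq, ?_⟩
  refine exists_mem_degreeLT_of_adjoin hσ₂ hB.generated ?_
    (fun k => ⟨algebraMap K C k, rfl⟩)
  rintro x (hx | rfl | rfl)
  · exact Or.inl ⟨⟨x, hA ⟨x, hx⟩⟩, rfl⟩
  · exact Or.inr rfl
  · exact Or.inl ⟨⟨x, hy⟩, rfl⟩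

end Forms

end DoubleOre

theorem corollary2p5 {K B : Type*} [Field K] [Ring B] [Algebra K B] (A : Subalgebra K B)
    (y₁ y₂ : B) (p₁₂ p₁₁ : K) (τ₀ τ₁ τ₂ : A)
    (σ : A → Matrix (Fin 2) (Fin 2) A) (δ : A → Fin 2 → A)
    (hB : DoubleOre.IsDoubleExtension A y₁ y₂ p₁₂ p₁₁ τ₀ τ₁ τ₂)
    (hσδ : DoubleOre.IsStructureMaps A y₁ y₂ σ δ)
    (h : (∀ a, σ a 0 1 = 0) ∨ ((∀ a, σ a 1 0 = 0) ∧ p₁₁ = 0)) :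
    (DoubleOre.IsLeftNoetherian A → DoubleOre.IsLeftNoetherian B) ∧
    (DoubleOre.IsRightNoetherian A → DoubleOre.IsRightNoetherian B) ∧
    (IsDomain A → IsDomain B) ∧
    (DoubleOre.IsPrimeRing A → DoubleOre.IsPrimeRing B) ∧
    (DoubleOre.IsSemiprimeRing A ∧ DoubleOre.IsLeftNoetherian A →
      DoubleOre.IsSemiprimeRing B ∧ DoubleOre.IsLeftNoetherian B) ∧
    (DoubleOre.IsSemiprimeRing A ∧ DoubleOre.IsRightNoetherian A →
      DoubleOre.IsSemiprimeRing B ∧ DoubleOre.IsRightNoetherian B) ∧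
    (DoubleOre.IsSemiprimeRing A ∧ DoubleOre.IsLeftGoldie A →
      DoubleOre.IsSemiprimeRing B ∧ DoubleOre.IsLeftGoldie B) ∧
    (DoubleOre.IsSemiprimeRing A ∧ DoubleOre.IsRightGoldie A →
      DoubleOre.IsSemiprimeRing B ∧ DoubleOre.IsRightGoldie B) := by
  rcases h with h12 | ⟨h21, rfl⟩
  · exact hB.transfersTo_of_lower hσδ h12
  · exact hB.transfersTo_of_upper hσδ h21
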